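/- Conventions. A \emph{double Boolean algebra} (dBa) is an algebra $\mathbf D=(D,\sqcup,\sqcap,\neg,\lrcorner,\top,\bot)$ of type $(2,2,1,1,0,0)$ such that, with $x\vee y:=\neg(\neg x\sqcap\neg y)$ and $x\wedge y:=\lrcorner(\lrcorner x\sqcup\lrcorner y)$, for all $x,y,z\in D$: $(x\sqcap x)\sqcap y=x\sqcap y$; $x\sqcap y=y\sqcap x$; $x\sqcap(y\sqcap z)=(x\sqcap y)\sqcap z$; $\neg(x\sqcap x)=\neg x$; $x\sqcap(x\sqcup y)=x\sqcap x$; $x\sqcap(y\vee z)=(x\sqcap y)\vee(x\sqcap z)$; $x\sqcap(x\vee y)=x\sqcap x$; $\neg\neg(x\sqcap y)=x\sqcap y$; $x\sqcap\neg x=\bot$; $\neg\bot=\top\sqcap\top$; $\neg\top=\bot$; the eleven dual identities, obtained by exchanging $\sqcap$ with $\sqcup$, $\neg$ with $\lrcorner$, $\vee$ with $\wedge$ and $\top$ with $\bot$; and $(x\sqcap x)\sqcup(x\sqcap x)=(x\sqcup x)\sqcap(x\sqcup x)$. It is \emph{pure} if every $x\in D$ satisfies $x\sqcap x=x$ or $x\sqcup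 x=x$. Write $x\sqsubseteq y$ if $x\sqcap y=x\sqcap x$ and $x\sqcup y=y\sqcup y$. A dBa isomorphism is a bijective map that preserves all the operations and constants. $\mathbf{PDBA}$ is the category of pure dBas and dBa isomorphisms. A \emph{filter} of $\mathbf D$ is a subset closed under $\sqcap$ and upward closed for $\sqsubseteq$; it is \emph{primary} if it is proper and contains $x$ or $\neg x$ for every $x\in D$. Dually, an \emph{ideal} is a subset closed under $\sqcup$ and downward closed for $\sqsubseteq$; it is \emph{primary} if it is proper and contains $x$ or $\lrcorner x$ for every $x\in D$. $\mathcal F_{pr}(\mathbf D)$ and $\mathcal I_{pr}(\mathbf D)$ denote the sets of primary filters and of primary ideals, with the topologies for which the sets $F_x=\{F: x\in F\}$ $(x\in D)$, respectively $I_x=\{I: x\in I\}$ $(x\in D)$, form a subbase for the closed sets. A \emph{context on topological spaces} $\mathbb K^T=(G,M,R)$ consists of topological spaces $G$, $M$ and a relation $R\subseteq G\times M$. Put $R(g)=\{m: gRm\}$, $R^{-1}(m)=\{g: gRm\}$, and, for $A\subseteq G$ and $B\subseteq M$, $A^{\blacksquare}=\{m: R^{-1}(m)\subseteq A\}$ and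 $B^{\lozenge}=\{g: R(g)\cap B\neq\emptyset\}$. It is a \emph{CTSCR} if $R$ and its converse are continuous, that is, both lower and upper semi-continuous as many-valued mappings $g\mapsto R(g)$ and $m\mapsto R^{-1}(m)$. A \emph{clopen object oriented semiconcept} is a pair $(A,B)$ of clopen sets $A\subseteq G$, $B\subseteq M$ with $A^{\blacksquare}=B$ or $B^{\lozenge}=A$. A \emph{Stone context} is a CTSCR such that $G$ and $M$ are Stone spaces (compact, and any two distinct points are separated by a clopen set) and such that $gRm$ holds whenever every clopen object oriented semiconcept $(A,B)$ with $m\in B$ satisfies $g\in A$. A \emph{CTSCR-homeomorphism} from $(G_1,M_1,R_1)$ to $(G_2,M_2,R_2)$ is a pair of homeomorphisms $\alpha:G_1\to G_2$, $\beta:M_1\to M_2$ with $gR_1m\iff\alpha(g)R_2\beta(m)$ for all $g\in G_1$, $m\in M_1$. $\mathbf{Scxt}$ is the category of Stone contexts and CTSCR-homeomorphisms, with componentwise composition. For a dBa $\mathbf D$ let $\mathbb K^T_{pr}(\mathbf D)=(\mathcal F_{pr}(\mathbf D),\mathcal I_{pr}(\mathbf D),\nabla)$, where $F\nabla I$ if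 and only if $F\cap I=\emptyset$. For a dBa isomorphism $f:\mathbf D\to\mathbf E$ let $\alpha_f(F)=f^{-1}(F)$ for $F\in\mathcal F_{pr}(\mathbf E)$ and $\beta_f(I)=f^{-1}(I)$ for $I\in\mathcal I_{pr}(\mathbf E)$. \textbf{Theorem.} For every pure dBa $\mathbf D$, $\mathbb K^T_{pr}(\mathbf D)$ is a Stone context; for every dBa isomorphism $f:\mathbf D\to\mathbf E$ of pure dBas, $(\alpha_f,\beta_f)$ is a CTSCR-homeomorphism from $\mathbb K^T_{pr}(\mathbf E)$ to $\mathbb K^T_{pr}(\mathbf D)$; and the functor $\mathbf D\mapsto\mathbb K^T_{pr}(\mathbf D)$, $f\mapsto(\alpha_f,\beta_f)$ is an equivalence of categories from $\mathbf{PDBA}$ to $\mathbf{Scxt}^{op}$. -/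

import Mathlib

open CategoryTheory

universe u

/-! ### Double Boolean algebras -/

/-- A double Boolean algebra `(D, ⊔, ⊓, neg, opp, ⊤, ⊥)`: `neg` is the negation `¬` that goes with
`⊓`, and `opp` is the opposition `⌟` that goes with `⊔`. The axioms use the derived operations
`x ∨ y = neg (neg x ⊓ neg y)` and `x ∧ y = opp (opp x ⊔ opp y)`, which are written out. -/
class DoubleBooleanAlgebra (D : Type u) extends Max D, Min D, Top D, Bot D where
  neg : D → D
  opp : D → D
  inf_self_inf : ∀ x y : D, (x ⊓ x) ⊓ y = x ⊓ y
  inf_comm' : ∀ x y : D, x ⊓ y = y ⊓ x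
  inf_assoc' : ∀ x y z : D, x ⊓ (y ⊓ z) = (x ⊓ y) ⊓ z
  neg_inf_self : ∀ x : D, neg (x ⊓ x) = neg x
  inf_sup_absorb : ∀ x y : D, x ⊓ (x ⊔ y) = x ⊓ x
  inf_vee : ∀ x y z : D, x ⊓ neg (neg y ⊓ neg z) = neg (neg (x ⊓ y) ⊓ neg (x ⊓ z))
  inf_vee_absorb : ∀ x y : D, x ⊓ neg (neg x ⊓ neg y) = x ⊓ x
  neg_neg_inf : ∀ x y : D, neg (neg (x ⊓ y)) = x ⊓ y
  inf_neg : ∀ x : D, x ⊓ neg x = ⊥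
  neg_bot : neg ⊥ = ⊤ ⊓ ⊤
  neg_top : neg ⊤ = ⊥
  sup_self_sup : ∀ x y : D, (x ⊔ x) ⊔ y = x ⊔ y
  sup_comm' : ∀ x y : D, x ⊔ y = y ⊔ x
  sup_assoc' : ∀ x y z : D, x ⊔ (y ⊔ z) = (x ⊔ y) ⊔ z
  opp_sup_self : ∀ x : D, opp (x ⊔ x) = opp x
  sup_inf_absorb : ∀ x y : D, x ⊔ (x ⊓ y) = x ⊔ x
  sup_wedge : ∀ x y z : D, x ⊔ opp (opp y ⊔ opp z) = opp (opp (x ⊔ y) ⊔ opp (x ⊔ z))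
  sup_wedge_absorb : ∀ x y : D, x ⊔ opp (opp x ⊔ opp y) = x ⊔ x
  opp_opp_sup : ∀ x y : D, opp (opp (x ⊔ y)) = x ⊔ y
  sup_opp : ∀ x : D, x ⊔ opp x = ⊤
  opp_top : opp ⊤ = ⊥ ⊔ ⊥
  opp_bot : opp ⊥ = ⊤
  inf_sup_self : ∀ x : D, (x ⊓ x) ⊔ (x ⊓ x) = (x ⊔ x) ⊓ (x ⊔ x)

namespace DoubleBooleanAlgebra

/-- The quasi-order `x ⊑ y` of a double Boolean algebra. -/
def QLe {D : Type u} [DoubleBooleanAlgebra D] (x y : D) : Prop :=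
  x ⊓ y = x ⊓ x ∧ x ⊔ y = y ⊔ y

/-- A double Boolean algebra is pure if each element is `⊓`-idempotent or `⊔`-idempotent. -/
def IsPure (D : Type u) [DoubleBooleanAlgebra D] : Prop :=
  ∀ x : D, x ⊓ x = x ∨ x ⊔ x = x

/-- Homomorphisms of double Boolean algebras. -/
structure IsHom {D E : Type u} [DoubleBooleanAlgebra D] [DoubleBooleanAlgebra E]
    (h : D → E) : Prop where
  map_inf : ∀ a b : D, h (a ⊓ b) = h a ⊓ h b
  map_sup : ∀ a b : D, h (a ⊔ b) = h a ⊔ h b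
  map_neg : ∀ a : D, h (neg a) = neg (h a)
  map_opp : ∀ a : D, h (opp a) = opp (h a)
  map_top : h ⊤ = ⊤
  map_bot : h ⊥ = ⊥

/-- An isomorphism of double Boolean algebras is a bijective homomorphism. -/
structure IsDBAIso {D E : Type u} [DoubleBooleanAlgebra D] [DoubleBooleanAlgebra E]
    (h : D → E) : Prop where
  isHom : IsHom h
  bijective : Function.Bijective h

/-- Filters of a double Boolean algebra. -/
structure IsFilter {D : Type u} [DoubleBooleanAlgebra D] (F : Set D) : Prop where
  inf_mem : ∀ x ∈ F, ∀ y ∈ F, x ⊓ y ∈ F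
  mem_of_le : ∀ x ∈ F, ∀ z : D, QLe x z → z ∈ F

/-- Ideals of a double Boolean algebra. -/
structure IsIdeal {D : Type u} [DoubleBooleanAlgebra D] (I : Set D) : Prop where
  sup_mem : ∀ x ∈ I, ∀ y ∈ I, x ⊔ y ∈ I
  mem_of_le : ∀ x ∈ I, ∀ z : D, QLe z x → z ∈ I

/-- Primary filters: proper filters that contain `x` or `neg x`, for every `x`. -/
structure IsPrimaryFilter {D : Type u} [DoubleBooleanAlgebra D] (F : Set D) : Prop where
  isFilter : IsFilter F
  proper : F ≠ Set.univ
  mem_or_neg_mem : ∀ x : D, x ∈ F ∨ neg x ∈ F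

/-- Primary ideals: proper ideals that contain `x` or `opp x`, for every `x`. -/
structure IsPrimaryIdeal {D : Type u} [DoubleBooleanAlgebra D] (I : Set D) : Prop where
  isIdeal : IsIdeal I
  proper : I ≠ Set.univ
  mem_or_opp_mem : ∀ x : D, x ∈ I ∨ opp x ∈ I

/-- The set of primary filters of `D`. -/
def PrimaryFilter (D : Type u) [DoubleBooleanAlgebra D] : Type u :=
  {F : Set D // IsPrimaryFilter F}

/-- The set of primary ideals of `D`. -/
def PrimaryIdeal (D : Type u) [DoubleBooleanAlgebra D] : Type u :=
  {I : Set D // IsPrimaryIdeal I}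

/-- The sets `F_x = {F | x ∈ F}` are a subbase for the closed sets of primary filters. -/
instance (D : Type u) [DoubleBooleanAlgebra D] : TopologicalSpace (PrimaryFilter D) :=
  TopologicalSpace.generateFrom {U | ∃ x : D, U = {F : PrimaryFilter D | x ∈ F.1}ᶜ}

/-- The sets `I_x = {I | x ∈ I}` are a subbase for the closed sets of primary ideals. -/
instance (D : Type u) [DoubleBooleanAlgebra D] : TopologicalSpace (PrimaryIdeal D) :=
  TopologicalSpace.generateFrom {U | ∃ x : D, U = {I : PrimaryIdeal D | x ∈ I.1}ᶜ}

theorem bot_qle {D : Type u} [DoubleBooleanAlgebra D] (x : D) : QLe ⊥ x := by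
  have h : ∀ y : D, y ⊓ ⊥ = ⊥ := fun y => by
    rw [← inf_neg y, inf_assoc', inf_self_inf]
  refine ⟨?_, ?_⟩
  · rw [inf_comm', h, h]
  · rw [sup_comm', ← inf_neg x, sup_inf_absorb]

theorem qle_top {D : Type u} [DoubleBooleanAlgebra D] (x : D) : QLe x ⊤ := by
  have h : ∀ y : D, y ⊔ ⊤ = ⊤ := fun y => by
    rw [← sup_opp y, sup_assoc', sup_self_sup]
  refine ⟨?_, ?_⟩
  · rw [← sup_opp x, inf_sup_absorb]
  · rw [h, h]

theorem IsHom.qle {D E : Type u} [DoubleBooleanAlgebra D] [DoubleBooleanAlgebra E] {h : D → E}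
    (hh : IsHom h) {x y : D} (hxy : QLe x y) : QLe (h x) (h y) :=
  ⟨by rw [← hh.map_inf, hxy.1, hh.map_inf], by rw [← hh.map_sup, hxy.2, hh.map_sup]⟩

theorem IsPrimaryFilter.preimage {D E : Type u} [DoubleBooleanAlgebra D]
    [DoubleBooleanAlgebra E] {h : D → E} (hh : IsHom h) {F : Set E} (hF : IsPrimaryFilter F) :
    IsPrimaryFilter (h ⁻¹' F) where
  isFilter :=
    { inf_mem := fun x hx y hy => by
        rw [Set.mem_preimage, hh.map_inf]
        exact hF.isFilter.inf_mem _ hx _ hy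
      mem_of_le := fun x hx z hz => hF.isFilter.mem_of_le _ hx _ (hh.qle hz) }
  proper := fun hu => hF.proper (Set.eq_univ_of_forall fun z => by
    have hb : (⊥ : D) ∈ h ⁻¹' F := hu ▸ Set.mem_univ _
    rw [Set.mem_preimage, hh.map_bot] at hb
    exact hF.isFilter.mem_of_le _ hb _ (bot_qle z))
  mem_or_neg_mem := fun x => by
    simpa [Set.mem_preimage, hh.map_neg] using hF.mem_or_neg_mem (h x)

theorem IsPrimaryIdeal.preimage {D E : Type u} [DoubleBooleanAlgebra D]
    [DoubleBooleanAlgebra E] {h : D → E} (hh : IsHom h) {I : Set E} (hI : IsPrimaryIdeal I) :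
    IsPrimaryIdeal (h ⁻¹' I) where
  isIdeal :=
    { sup_mem := fun x hx y hy => by
        rw [Set.mem_preimage, hh.map_sup]
        exact hI.isIdeal.sup_mem _ hx _ hy
      mem_of_le := fun x hx z hz => hI.isIdeal.mem_of_le _ hx _ (hh.qle hz) }
  proper := fun hu => hI.proper (Set.eq_univ_of_forall fun z => by
    have hb : (⊤ : D) ∈ h ⁻¹' I := hu ▸ Set.mem_univ _
    rw [Set.mem_preimage, hh.map_top] at hb
    exact hI.isIdeal.mem_of_le _ hb _ (qle_top z))
  mem_or_opp_mem := fun x => by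
    simpa [Set.mem_preimage, hh.map_opp] using hI.mem_or_opp_mem (h x)

/-- The map `α_h : F ↦ h⁻¹(F)` on primary filters induced by a homomorphism `h`. -/
def alphaMap {D E : Type u} [DoubleBooleanAlgebra D] [DoubleBooleanAlgebra E] {h : D → E}
    (hh : IsHom h) (F : PrimaryFilter E) : PrimaryFilter D :=
  ⟨h ⁻¹' F.1, F.2.preimage hh⟩

/-- The map `β_h : I ↦ h⁻¹(I)` on primary ideals induced by a homomorphism `h`. -/
def betaMap {D E : Type u} [DoubleBooleanAlgebra D] [DoubleBooleanAlgebra E] {h : D → E}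
    (hh : IsHom h) (I : PrimaryIdeal E) : PrimaryIdeal D :=
  ⟨h ⁻¹' I.1, I.2.preimage hh⟩

end DoubleBooleanAlgebra

open DoubleBooleanAlgebra

/-! ### Contexts on topological spaces -/

/-- A context on topological spaces (CTS) `((G, ρ), (M, τ), R)`. -/
structure CTS : Type (u + 1) where
  G : Type u
  M : Type u
  [topG : TopologicalSpace G]
  [topM : TopologicalSpace M]
  R : G → M → Prop

attribute [instance] CTS.topG CTS.topM

namespace CTS

/-- `R(g)`, the set of properties related to `g`. -/
def image (K : CTS.{u}) (g : K.G) : Set K.M := {m | K.R g m}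

/-- `R⁻¹(m)`, the set of objects related to `m`. -/
def fiber (K : CTS.{u}) (m : K.M) : Set K.G := {g | K.R g m}

/-- `B^◇ = {g | R(g) ∩ B ≠ ∅}`. -/
def diamond (K : CTS.{u}) (B : Set K.M) : Set K.G := {g | (K.image g ∩ B).Nonempty}

/-- `A^■ = {m | R⁻¹(m) ⊆ A}`. -/
def blackBox (K : CTS.{u}) (A : Set K.G) : Set K.M := {m | K.fiber m ⊆ A}

/-- `(A, B)` is a clopen object oriented semiconcept of `K`. -/
structure IsClopenSemiconcept (K : CTS.{u}) (A : Set K.G) (B : Set K.M) : Prop where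
  semiconcept : K.blackBox A = B ∨ K.diamond B = A
  clopen_fst : IsClopen A
  clopen_snd : IsClopen B

/-- A CTSCR is a CTS for which `R` and its converse are continuous, that is, both lower and
upper semi-continuous as many-valued mappings. -/
structure IsCTSCR (K : CTS.{u}) : Prop where
  lower : LowerHemicontinuous K.image
  upper : UpperHemicontinuous K.image
  lower_inv : LowerHemicontinuous K.fiber
  upper_inv : UpperHemicontinuous K.fiber

/-- A Stone context is a CTSCR on two Stone spaces (compact spaces in which any two distinct
points are separated by a clopen set) in which `g R m` holds as soon as every clopen object
oriented semiconcept `(A, B)` with `m ∈ B` has `g ∈ A`. -/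
structure IsStoneContext (K : CTS.{u}) : Prop where
  isCTSCR : K.IsCTSCR
  compact_G : CompactSpace K.G
  separated_G : TotallySeparatedSpace K.G
  compact_M : CompactSpace K.M
  separated_M : TotallySeparatedSpace K.M
  rel_of_forall : ∀ (g : K.G) (m : K.M),
    (∀ (A : Set K.G) (B : Set K.M), K.IsClopenSemiconcept A B → m ∈ B → g ∈ A) → K.R g m

/-- `(α, β)` is a CTS-homeomorphism from `K` to `L` (called a CTSCR-homeomorphism when `K` and
`L` are CTSCRs): `α` and `β` are homeomorphisms and `g R m ↔ α(g) R β(m)`. -/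
structure IsHomeo (K L : CTS.{u}) (α : K.G → L.G) (β : K.M → L.M) : Prop where
  rel_iff : ∀ (g : K.G) (m : K.M), K.R g m ↔ L.R (α g) (β m)
  homeo_fst : IsHomeomorph α
  homeo_snd : IsHomeomorph β

end CTS

/-! ### The two categories -/

/-- Pure double Boolean algebras. -/
structure PDBA : Type (u + 1) where
  carrier : Type u
  [algebra : DoubleBooleanAlgebra carrier]
  isPure : IsPure carrier

attribute [instance] PDBA.algebra

namespace PDBA

/-- A morphism of `PDBA` is an isomorphism of double Boolean algebras. -/
@[ext]
structure Hom (D E : PDBA.{u}) : Type u where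
  toFun : D.carrier → E.carrier
  isDBAIso : IsDBAIso toFun

instance : Category.{u} PDBA.{u} where
  Hom D E := Hom D E
  id D := ⟨id, ⟨⟨fun _ _ => rfl, fun _ _ => rfl, fun _ => rfl, fun _ => rfl, rfl, rfl⟩,
    Function.bijective_id⟩⟩
  comp f g := ⟨g.toFun ∘ f.toFun,
    ⟨⟨fun a b => by simp [f.isDBAIso.isHom.map_inf, g.isDBAIso.isHom.map_inf],
      fun a b => by simp [f.isDBAIso.isHom.map_sup, g.isDBAIso.isHom.map_sup],
      fun a => by simp [f.isDBAIso.isHom.map_neg, g.isDBAIso.isHom.map_neg],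
      fun a => by simp [f.isDBAIso.isHom.map_opp, g.isDBAIso.isHom.map_opp],
      by simp [f.isDBAIso.isHom.map_top, g.isDBAIso.isHom.map_top],
      by simp [f.isDBAIso.isHom.map_bot, g.isDBAIso.isHom.map_bot]⟩,
      g.isDBAIso.bijective.comp f.isDBAIso.bijective⟩⟩

end PDBA

/-- Stone contexts. -/
structure Scxt : Type (u + 1) where
  toCTS : CTS.{u}
  isStoneContext : toCTS.IsStoneContext

namespace Scxt

/-- A morphism of `Scxt` is a CTSCR-homeomorphism. -/
@[ext]
structure Hom (K L : Scxt.{u}) : Type u where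
  α : K.toCTS.G → L.toCTS.G
  β : K.toCTS.M → L.toCTS.M
  isHomeo : CTS.IsHomeo K.toCTS L.toCTS α β

instance : Category.{u} Scxt.{u} where
  Hom K L := Hom K L
  id K := ⟨id, id, ⟨fun _ _ => Iff.rfl, IsHomeomorph.id, IsHomeomorph.id⟩⟩
  comp f g := ⟨g.α ∘ f.α, g.β ∘ f.β,
    ⟨fun a b => (f.isHomeo.rel_iff a b).trans (g.isHomeo.rel_iff _ _),
      g.isHomeo.homeo_fst.comp f.isHomeo.homeo_fst,
      g.isHomeo.homeo_snd.comp f.isHomeo.homeo_snd⟩⟩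

end Scxt

/-! ### The functor -/

/-- The CTS of primary filters and primary ideals of `D`, with `F ∇ I` if and only if
`F ∩ I = ∅`. -/
def primaryContext (D : Type u) [DoubleBooleanAlgebra D] : CTS.{u} where
  G := PrimaryFilter D
  M := PrimaryIdeal D
  R F I := F.1 ∩ I.1 = ∅

/-- The functor `D ↦ primaryContext D`, `f ↦ (α_f, β_f)`. Its two arguments say that it is
well defined on objects and on morphisms. -/
def primaryContextFunctor
    (hobj : ∀ D : PDBA.{u}, (primaryContext D.carrier).IsStoneContext)
    (hmap : ∀ (D E : PDBA.{u}) (f : D ⟶ E),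
      CTS.IsHomeo (primaryContext E.carrier) (primaryContext D.carrier)
        (alphaMap f.isDBAIso.isHom) (betaMap f.isDBAIso.isHom)) :
    PDBA.{u} ⥤ Scxt.{u}ᵒᵖ where
  obj D := Opposite.op ⟨primaryContext D.carrier, hobj D⟩
  map {D E} f := Quiver.Hom.op
    (X := (⟨primaryContext E.carrier, hobj E⟩ : Scxt.{u}))
    (Y := (⟨primaryContext D.carrier, hobj D⟩ : Scxt.{u}))
    ⟨alphaMap f.isDBAIso.isHom, betaMap f.isDBAIso.isHom, hmap D E f⟩
  map_id _ := rfl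
  map_comp _ _ := rfl

/-! This is Stone duality carried out on both sides of a double Boolean algebra at once. A primary
filter sees only the `⊓`-part `x ⊓ x` of an element and a primary ideal only its `⊔`-part, so each
of the two spaces is the Stone space of a Boolean algebra: it is compact and totally separated, and
its clopen sets are the `F_x` with `x` `⊓`-idempotent, respectively the `I_x` with `x`
`⊔`-idempotent.

The relation is controlled by `IsPrimaryIdeal.exists_disjoint`: if `x ⊓ x ∉ I`, some primary filter
contains `x` and misses `I`. Hence `■` sends the complement of `F_x` to `I_x` for `⊓`-idempotent
`x`, and dually for `◇`. So `■` and `◇` preserve clopen sets, which gives continuity, and in a pure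
algebra the clopen semiconcepts are exactly the pairs `(F_xᶜ, I_x)`.

A pure algebra is therefore recovered from its context. Elements are separated by filters and ideals
(`eq_of_forall_mem_iff`), whence faithfulness. A homeomorphism pulls semiconcepts back to
semiconcepts and so induces a map of elements (`exists_isDBAIso_of_isHomeo`), whence fullness.
Conversely the clopen semiconcepts of a Stone context form a pure algebra whose primary filters and
ideals are given by points (`isHomeo_filterOf_idealOf`), whence essential surjectivity. Statements
about ideals are obtained from those about filters through `Dual`, where possible. -/

namespace DoubleBooleanAlgebra

variable {D : Type u} [DoubleBooleanAlgebra D]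

/-! ### Duality -/

/-- The dual of a double Boolean algebra, in which `⊓` and `⊔`, `neg` and `opp`, `⊤` and `⊥` are
exchanged. -/
def Dual (D : Type u) : Type u := D

instance : DoubleBooleanAlgebra (Dual D) where
  max := fun x y => (Min.min x y : D)
  min := fun x y => (Max.max x y : D)
  top := (⊥ : D)
  bot := (⊤ : D)
  neg := (opp : D → D)
  opp := (neg : D → D)
  inf_self_inf := sup_self_sup (D := D)
  inf_comm' := sup_comm' (D := D)
  inf_assoc' := sup_assoc' (D := D)
  neg_inf_self := opp_sup_self (D := D)
  inf_sup_absorb := sup_inf_absorb (D := D)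
  inf_vee := sup_wedge (D := D)
  inf_vee_absorb := sup_wedge_absorb (D := D)
  neg_neg_inf := opp_opp_sup (D := D)
  inf_neg := sup_opp (D := D)
  neg_bot := opp_top (D := D)
  neg_top := opp_bot (D := D)
  sup_self_sup := inf_self_inf (D := D)
  sup_comm' := inf_comm' (D := D)
  sup_assoc' := inf_assoc' (D := D)
  opp_sup_self := neg_inf_self (D := D)
  sup_inf_absorb := inf_sup_absorb (D := D)
  sup_wedge := inf_vee (D := D)
  sup_wedge_absorb := inf_vee_absorb (D := D)
  opp_opp_sup := neg_neg_inf (D := D)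
  sup_opp := inf_neg (D := D)
  opp_top := neg_bot (D := D)
  opp_bot := neg_top (D := D)
  inf_sup_self := fun x => (inf_sup_self (D := D) x).symm

theorem qle_dual_iff {x y : D} : QLe (D := Dual D) x y ↔ QLe (D := D) y x := by
  change (x ⊔ y = x ⊔ x ∧ x ⊓ y = y ⊓ y) ↔ (y ⊓ x = y ⊓ y ∧ y ⊔ x = x ⊔ x)
  rw [sup_comm' x y, inf_comm' x y, and_comm]

theorem isFilter_dual_iff {I : Set D} : IsFilter (D := Dual D) I ↔ IsIdeal (D := D) I :=
  ⟨fun h => ⟨h.1, fun x hx z hz => h.2 x hx z (qle_dual_iff.2 hz)⟩,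
    fun h => ⟨h.1, fun x hx z hz => h.2 x hx z (qle_dual_iff.1 hz)⟩⟩

theorem isIdeal_dual_iff {F : Set D} : IsIdeal (D := Dual D) F ↔ IsFilter (D := D) F :=
  ⟨fun h => ⟨h.1, fun x hx z hz => h.2 x hx z (qle_dual_iff.2 hz)⟩,
    fun h => ⟨h.1, fun x hx z hz => h.2 x hx z (qle_dual_iff.1 hz)⟩⟩

theorem isPrimaryFilter_dual_iff {I : Set D} :
    IsPrimaryFilter (D := Dual D) I ↔ IsPrimaryIdeal (D := D) I :=
  ⟨fun h => ⟨isFilter_dual_iff.1 h.1, h.2, h.3⟩, fun h => ⟨isFilter_dual_iff.2 h.1, h.2, h.3⟩⟩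

theorem isPrimaryIdeal_dual_iff {F : Set D} :
    IsPrimaryIdeal (D := Dual D) F ↔ IsPrimaryFilter (D := D) F :=
  ⟨fun h => ⟨isIdeal_dual_iff.1 h.1, h.2, h.3⟩, fun h => ⟨isIdeal_dual_iff.2 h.1, h.2, h.3⟩⟩

theorem isPure_dual (h : IsPure D) : IsPure (Dual D) := fun x => (h x).symm

/-! ### Elementary identities -/

theorem inf_inf_self (x y : D) : x ⊓ (x ⊓ y) = x ⊓ y := by
  rw [inf_assoc', inf_self_inf]

theorem inf_inf_inf_comm (x y z w : D) : (x ⊓ y) ⊓ (z ⊓ w) = (x ⊓ z) ⊓ (y ⊓ w) := by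
  rw [inf_assoc', inf_assoc', ← inf_assoc' x y z, inf_comm' y z, inf_assoc' x z y]

theorem inf_idem_inf (x y : D) : (x ⊓ y) ⊓ (x ⊓ y) = x ⊓ y := by
  rw [inf_inf_inf_comm, inf_self_inf, inf_comm', inf_self_inf, inf_comm']

theorem inf_bot' (x : D) : x ⊓ ⊥ = ⊥ := by
  rw [← inf_neg x, inf_inf_self]

theorem inf_top' (x : D) : x ⊓ ⊤ = x ⊓ x := (qle_top x).1

theorem neg_neg' (x : D) : neg (neg x) = x ⊓ x := by
  rw [← neg_inf_self x, neg_neg_inf]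

theorem inf_right_qle (x y : D) : QLe (x ⊓ y) y :=
  ⟨by rw [inf_idem_inf, ← inf_assoc', inf_comm', inf_self_inf, inf_comm'],
    by rw [sup_comm', inf_comm', sup_inf_absorb]⟩

theorem inf_left_qle (x y : D) : QLe (x ⊓ y) x := inf_comm' y x ▸ inf_right_qle y x

theorem neg_inf_idem (x : D) : neg x ⊓ neg x = neg x :=
  (neg_neg' (neg x)).symm.trans ((congrArg neg (neg_neg' x)).trans (neg_inf_self x))

/-- Distribute `x` over `y ∨ ¬y = ⊤ ⊓ ⊤`: the term `x ⊓ y` drops out. -/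
theorem inf_neg_of_inf_eq_bot {x y : D} (h : x ⊓ y = ⊥) : x ⊓ neg y = x ⊓ x := by
  have h1 := inf_vee x y (neg y)
  have h2 : neg (neg y ⊓ neg (neg y)) = (⊤ : D) ⊓ ⊤ := by rw [inf_neg, neg_bot]
  rw [h2, h, neg_bot] at h1
  rw [inf_assoc', inf_top', inf_idem_inf, inf_comm' ((⊤ : D) ⊓ ⊤), inf_assoc', inf_top',
    inf_top', inf_idem_inf, inf_top', neg_inf_idem, neg_neg_inf] at h1
  exact h1.symm

theorem inf_eq_of_inf_neg_eq_bot {x y : D} (h : x ⊓ neg y = ⊥) : x ⊓ y = x ⊓ x := by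
  rw [← inf_neg_of_inf_eq_bot h, neg_neg', inf_comm' x (y ⊓ y), inf_self_inf, inf_comm']

/-- The hypothesis is only the meet half of `x ⊑ y`. Passing to the `⊓`-part supplies the join half
by absorption. -/
theorem inf_self_qle_of_inf_eq {x y : D} (h : x ⊓ y = x ⊓ x) : QLe (x ⊓ x) y :=
  h ▸ inf_right_qle x y

/-! ### Membership in primary filters -/

theorem IsFilter.inf_mem_iff {F : Set D} (hF : IsFilter F) {x y : D} :
    x ⊓ y ∈ F ↔ x ∈ F ∧ y ∈ F :=
  ⟨fun h => ⟨hF.mem_of_le _ h _ (inf_left_qle x y), hF.mem_of_le _ h _ (inf_right_qle x y)⟩,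
    fun h => hF.inf_mem _ h.1 _ h.2⟩

namespace IsPrimaryFilter

variable {F : Set D}

theorem bot_notMem (hF : IsPrimaryFilter F) : ⊥ ∉ F := fun h =>
  hF.proper (Set.eq_univ_of_forall fun z => hF.isFilter.mem_of_le _ h z (bot_qle z))

theorem neg_mem_iff (hF : IsPrimaryFilter F) {x : D} : neg x ∈ F ↔ x ∉ F :=
  ⟨fun h hx => hF.bot_notMem (inf_neg x ▸ hF.isFilter.inf_mem _ hx _ h),
    fun h => (hF.mem_or_neg_mem x).resolve_left h⟩

theorem top_mem (hF : IsPrimaryFilter F) : ⊤ ∈ F := by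
  by_contra h
  exact hF.bot_notMem (neg_top (D := D) ▸ hF.neg_mem_iff.2 h)

end IsPrimaryFilter

theorem IsPrimaryIdeal.top_notMem {I : Set D} (hI : IsPrimaryIdeal I) : ⊤ ∉ I :=
  IsPrimaryFilter.bot_notMem (D := Dual D) (isPrimaryFilter_dual_iff.2 hI)

theorem IsPrimaryIdeal.opp_mem_iff {I : Set D} (hI : IsPrimaryIdeal I) {x : D} :
    opp x ∈ I ↔ x ∉ I :=
  IsPrimaryFilter.neg_mem_iff (D := Dual D) (isPrimaryFilter_dual_iff.2 hI)

theorem IsPrimaryIdeal.bot_mem {I : Set D} (hI : IsPrimaryIdeal I) : ⊥ ∈ I :=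
  IsPrimaryFilter.top_mem (D := Dual D) (isPrimaryFilter_dual_iff.2 hI)

/-! ### Existence of primary filters -/

/-- Filters are generated from a base of `⊓`-idempotents: for such `w` the meet half of `w ⊑ z`
reads `w ⊓ z = w`, and this half alone is enough for upward closure. -/
theorem isFilter_of_inf {S : Set D}
    (hS : ∀ x ∈ S, ∀ y ∈ S, ∃ w ∈ S, QLe w x ∧ QLe w y) (hi : ∀ x ∈ S, x ⊓ x = x) :
    IsFilter {z : D | ∃ w ∈ S, w ⊓ z = w} where
  inf_mem := by
    rintro x ⟨v, hv, hvx⟩ y ⟨w, hw, hwy⟩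
    obtain ⟨t, ht, htv, htw⟩ := hS v hv w hw
    have hv' : t ⊓ v = t := htv.1.trans (hi t ht)
    have hw' : t ⊓ w = t := htw.1.trans (hi t ht)
    have hx : t ⊓ x = t := by rw [← hv', ← inf_assoc', hvx]
    have hy : t ⊓ y = t := by rw [← hw', ← inf_assoc', hwy]
    exact ⟨t, ht, by rw [inf_assoc', hx, hy]⟩
  mem_of_le := by
    rintro x ⟨v, hv, hvx⟩ z hz
    refine ⟨v, hv, ?_⟩
    rw [← hvx, ← inf_assoc', hz.1, inf_comm' v, inf_self_inf, inf_comm']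

/-- A filter that does not contain `⊥` extends to a primary filter. -/
theorem IsFilter.exists_isPrimaryFilter {F : Set D} (hF : IsFilter F) (hne : F.Nonempty)
    (hb : ⊥ ∉ F) : ∃ P : Set D, F ⊆ P ∧ IsPrimaryFilter P := by
  obtain ⟨P, hFP, hP⟩ := zorn_subset_nonempty {P : Set D | IsFilter P ∧ ⊥ ∉ P} (by
    intro c hc hchain hcne
    refine ⟨⋃₀ c, ⟨⟨?_, ?_⟩, ?_⟩, fun s hs => Set.subset_sUnion_of_mem hs⟩
    · rintro x ⟨s, hs, hx⟩ y ⟨t, ht, hy⟩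
      rcases hchain.total hs ht with h | h
      · exact ⟨t, ht, (hc ht).1.inf_mem _ (h hx) _ hy⟩
      · exact ⟨s, hs, (hc hs).1.inf_mem _ hx _ (h hy)⟩
    · rintro x ⟨s, hs, hx⟩ z hz
      exact ⟨s, hs, (hc hs).1.mem_of_le _ hx _ hz⟩
    · rintro ⟨s, hs, h⟩
      exact (hc hs).2 h) F ⟨hF, hb⟩
  obtain ⟨⟨hPf, hPb⟩, hmax⟩ := hP
  refine ⟨P, hFP, hPf, fun h => hPb (h ▸ Set.mem_univ _), fun x => or_iff_not_imp_left.2 ?_⟩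
  intro hx
  -- The filter generated by `P` and `x`. If it contains `⊥`, some `f ∈ P` has `f ⊓ x = ⊥`, so `f ⊓
  -- neg x = f ⊓ f` lies in `P`. Otherwise maximality forces `x ∈ P`.
  have hG : IsFilter {z : D | ∃ w ∈ (fun f => f ⊓ x) '' P, w ⊓ z = w} := by
    refine isFilter_of_inf ?_ ?_
    · rintro _ ⟨f, hf, rfl⟩ _ ⟨g, hg, rfl⟩
      refine ⟨_, ⟨f ⊓ g, hPf.inf_mem _ hf _ hg, rfl⟩, ?_⟩
      have h : (f ⊓ g) ⊓ x = (f ⊓ x) ⊓ (g ⊓ x) := by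
        rw [inf_inf_inf_comm, inf_comm' (f ⊓ g) (x ⊓ x), inf_self_inf, inf_comm']
      change QLe ((f ⊓ g) ⊓ x) (f ⊓ x) ∧ QLe ((f ⊓ g) ⊓ x) (g ⊓ x)
      rw [h]
      exact ⟨inf_left_qle _ _, inf_right_qle _ _⟩
    · rintro _ ⟨f, -, rfl⟩
      exact inf_idem_inf _ _
  by_cases hGb : (⊥ : D) ∈ {z : D | ∃ w ∈ (fun f => f ⊓ x) '' P, w ⊓ z = w}
  · obtain ⟨_, ⟨f, hf, rfl⟩, h⟩ := hGb
    rw [inf_bot'] at h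
    have h2 := inf_neg_of_inf_eq_bot h.symm
    exact (hPf.inf_mem_iff.1 (h2 ▸ hPf.inf_mem _ hf _ hf)).2
  · exfalso
    have hsub : P ⊆ {z : D | ∃ w ∈ (fun f => f ⊓ x) '' P, w ⊓ z = w} := fun f hf =>
      ⟨_, ⟨f, hf, rfl⟩, by
        change (f ⊓ x) ⊓ f = f ⊓ x
        rw [inf_comm', inf_inf_self]⟩
    obtain ⟨f, hf⟩ := hne
    exact hx (hmax ⟨hG, hGb⟩ hsub ⟨_, ⟨f, hFP hf, rfl⟩, by
      change (f ⊓ x) ⊓ x = f ⊓ x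
      rw [inf_comm' f x, inf_comm', inf_inf_self]⟩)

/-- Extend the filter generated by the single element `x ⊓ neg y`. -/
theorem exists_isPrimaryFilter_of_inf_neg_ne_bot {x y : D} (h : x ⊓ neg y ≠ ⊥) :
    ∃ F : Set D, IsPrimaryFilter F ∧ x ∈ F ∧ y ∉ F := by
  have hG : IsFilter {z : D | ∃ w ∈ ({x ⊓ neg y} : Set D), w ⊓ z = w} := by
    refine isFilter_of_inf ?_ ?_
    · rintro _ rfl _ rfl
      exact ⟨_, rfl, ⟨rfl, rfl⟩, ⟨rfl, rfl⟩⟩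
    · rintro _ rfl
      exact inf_idem_inf _ _
  have hm : x ⊓ neg y ∈ {z : D | ∃ w ∈ ({x ⊓ neg y} : Set D), w ⊓ z = w} :=
    ⟨_, rfl, inf_idem_inf _ _⟩
  obtain ⟨P, hGP, hP⟩ := hG.exists_isPrimaryFilter ⟨_, hm⟩ (by
    rintro ⟨_, rfl, hb⟩
    exact h (by rw [← hb, inf_bot']))
  have := hP.isFilter.inf_mem_iff.1 (hGP hm)
  exact ⟨P, hP, this.1, hP.neg_mem_iff.1 this.2⟩

/-- Two elements in the same primary filters have the same `⊓`-part. -/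
theorem inf_self_eq_of_forall {x y : D} (h : ∀ F : Set D, IsPrimaryFilter F → (x ∈ F ↔ y ∈ F)) :
    x ⊓ x = y ⊓ y := by
  have key : ∀ {x y : D}, (∀ F : Set D, IsPrimaryFilter F → (x ∈ F ↔ y ∈ F)) →
      x ⊓ y = x ⊓ x := fun {x y} h => by
    refine inf_eq_of_inf_neg_eq_bot ?_
    by_contra hne
    obtain ⟨F, hF, hx, hy⟩ := exists_isPrimaryFilter_of_inf_neg_ne_bot hne
    exact hy ((h F hF).1 hx)
  rw [← key h, inf_comm', key fun F hF => (h F hF).symm]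

theorem sup_self_eq_of_forall {x y : D} (h : ∀ I : Set D, IsPrimaryIdeal I → (x ∈ I ↔ y ∈ I)) :
    x ⊔ x = y ⊔ y :=
  inf_self_eq_of_forall (D := Dual D) fun I hI => h I (isPrimaryFilter_dual_iff.1 hI)

/-- An element whose `⊓`-part is outside a primary ideal lies in a primary filter disjoint from
that ideal. -/
theorem IsPrimaryIdeal.exists_disjoint {I : Set D} (hI : IsPrimaryIdeal I) {x : D}
    (hx : x ⊓ x ∉ I) : ∃ F : Set D, IsPrimaryFilter F ∧ x ∈ F ∧ F ∩ I = ∅ := by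
  -- The elements `x ⊓ neg j` with `j ∈ I` form a directed base, because `I` is closed under `⊔` and
  -- `neg (i ⊔ j)` lies below `neg i` and `neg j`. A filter containing all of them contains `x` and
  -- misses `I`.
  have hG : IsFilter {z : D | ∃ w ∈ (fun j => x ⊓ neg j) '' I, w ⊓ z = w} := by
    refine isFilter_of_inf ?_ ?_
    · have key : ∀ i j : D, QLe (x ⊓ neg (i ⊔ j)) (x ⊓ neg i) := fun i j => by
        have h1 : neg (i ⊔ j) ⊓ i = ⊥ := by
          have h2 : i ⊓ i ⊓ neg (i ⊔ j) = ⊥ := by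
            rw [← inf_sup_absorb i j, ← inf_assoc', inf_neg, inf_bot']
          rw [inf_comm', ← h2, inf_self_inf]
        have h3 := inf_neg_of_inf_eq_bot h1
        rw [neg_inf_idem] at h3
        have h4 : x ⊓ neg (i ⊔ j) = neg (i ⊔ j) ⊓ (x ⊓ neg i) := by
          rw [inf_assoc', inf_comm' _ x, ← inf_assoc', h3]
        exact h4 ▸ inf_right_qle _ _
      rintro _ ⟨i, hi, rfl⟩ _ ⟨j, hj, rfl⟩
      exact ⟨_, ⟨i ⊔ j, hI.isIdeal.sup_mem _ hi _ hj, rfl⟩, key i j, sup_comm' j i ▸ key j i⟩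
    · rintro _ ⟨j, -, rfl⟩
      exact inf_idem_inf _ _
  have hm : ∀ j ∈ I, x ⊓ neg j ∈ {z : D | ∃ w ∈ (fun j => x ⊓ neg j) '' I, w ⊓ z = w} :=
    fun j hj => ⟨_, ⟨j, hj, rfl⟩, inf_idem_inf _ _⟩
  -- Properness: `x ⊓ neg j = ⊥` would give `x ⊓ x ⊑ j`, putting `x ⊓ x` into `I`.
  obtain ⟨P, hGP, hP⟩ := hG.exists_isPrimaryFilter ⟨_, hm _ hI.bot_mem⟩ (by
    rintro ⟨_, ⟨j, hj, rfl⟩, h⟩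
    rw [inf_bot'] at h
    exact hx (hI.isIdeal.mem_of_le _ hj _
      (inf_self_qle_of_inf_eq (inf_eq_of_inf_neg_eq_bot h.symm))))
  refine ⟨P, hP, (hP.isFilter.inf_mem_iff.1 (hGP (hm _ hI.bot_mem))).1, ?_⟩
  refine Set.eq_empty_of_forall_notMem fun j hj => ?_
  exact hP.neg_mem_iff.1 (hP.isFilter.inf_mem_iff.1 (hGP (hm j hj.2))).2 hj.1

theorem IsPrimaryFilter.exists_disjoint {F : Set D} (hF : IsPrimaryFilter F) {x : D}
    (hx : x ⊔ x ∉ F) : ∃ I : Set D, IsPrimaryIdeal I ∧ x ∈ I ∧ F ∩ I = ∅ := by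
  obtain ⟨I, hI, hxI, hd⟩ :=
    IsPrimaryIdeal.exists_disjoint (D := Dual D) (isPrimaryIdeal_dual_iff.2 hF) hx
  exact ⟨I, isPrimaryFilter_dual_iff.1 hI, hxI, Set.inter_comm F I ▸ hd⟩

/-! ### The topology of primary filters -/

theorem isClopen_setOf_mem_primaryFilter (x : D) :
    IsClopen {F : PrimaryFilter D | x ∈ F.1} := by
  have h : ∀ y : D, IsClosed {F : PrimaryFilter D | y ∈ F.1} := fun y =>
    ⟨TopologicalSpace.isOpen_generateFrom_of_mem ⟨y, rfl⟩⟩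
  refine ⟨h x, ?_⟩
  rw [← isClosed_compl_iff]
  convert h (neg x) using 1
  ext F
  exact F.2.neg_mem_iff.symm

/-- An ultrafilter `f` on the space converges to the set of those `x` with `F_x ∈ f`, which is
itself a primary filter. -/
instance : CompactSpace (PrimaryFilter D) := by
  refine ⟨isCompact_iff_ultrafilter_le_nhds.2 fun f _ => ?_⟩
  let P : Set D := {x | {F : PrimaryFilter D | x ∈ F.1} ∈ f}
  have hP : IsPrimaryFilter P := by
    refine ⟨⟨fun x hx y hy => ?_, fun x hx z hz => ?_⟩, fun h => ?_, fun x => ?_⟩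
    · filter_upwards [hx, hy] with F h1 h2 using F.2.isFilter.inf_mem _ h1 _ h2
    · filter_upwards [hx] with F h1 using F.2.isFilter.mem_of_le _ h1 _ hz
    · have hb : (⊥ : D) ∈ P := h ▸ Set.mem_univ _
      obtain ⟨F, hF⟩ := f.nonempty_of_mem hb
      exact F.2.bot_notMem hF
    · refine (f.mem_or_compl_mem {F : PrimaryFilter D | x ∈ F.1}).imp id fun h => ?_
      filter_upwards [h] with F hF using F.2.neg_mem_iff.2 hF
  refine ⟨(⟨P, hP⟩ : PrimaryFilter D), trivial, ?_⟩
  refine le_of_le_of_eq (le_iInf₂ ?_) TopologicalSpace.nhds_generateFrom.symm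
  rintro s ⟨hs, x, rfl⟩
  exact Filter.le_principal_iff.2 ((Ultrafilter.compl_mem_iff_notMem).2 hs)

instance : TotallySeparatedSpace (PrimaryFilter D) := by
  refine totallySeparatedSpace_iff_exists_isClopen.2 fun F F' hne => ?_
  by_cases h : F.1 ⊆ F'.1
  · have h' : ¬ F'.1 ⊆ F.1 := fun h' => hne (Subtype.ext (h.antisymm h'))
    obtain ⟨x, hx', hx⟩ := Set.not_subset.1 h'
    exact ⟨_, (isClopen_setOf_mem_primaryFilter x).compl, hx, fun h => h hx'⟩
  · obtain ⟨x, hx, hx'⟩ := Set.not_subset.1 h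
    exact ⟨_, isClopen_setOf_mem_primaryFilter x, hx, hx'⟩

/-- The sets `F_x` are closed under finite unions (through `∨`) and complements (through `neg`), so
with the whole space they form a basis. Compactness writes a clopen set as a finite union of them,
and `x` may be replaced by `x ⊓ x`. -/
theorem exists_eq_setOf_mem_primaryFilter {A : Set (PrimaryFilter D)} (hA : IsClopen A) :
    ∃ x : D, x ⊓ x = x ∧ A = {F : PrimaryFilter D | x ∈ F.1} := by
  have hbasis := TopologicalSpace.isTopologicalBasis_of_subbasis_of_inter
    (t := (inferInstance : TopologicalSpace (PrimaryFilter D))) rfl (by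
      rintro _ ⟨x, rfl⟩ _ ⟨y, rfl⟩
      refine ⟨neg (neg x ⊓ neg y), ?_⟩
      ext F
      simp only [Set.mem_inter_iff, Set.mem_compl_iff, Set.mem_ofPred_eq, ← F.2.neg_mem_iff,
        F.2.isFilter.inf_mem_iff, neg_neg', and_self])
  obtain ⟨x, hx⟩ : ∃ x : D, A ⊆ {F : PrimaryFilter D | x ∈ F.1} ∧
      {F : PrimaryFilter D | x ∈ F.1} ⊆ A := by
    -- Compact induction on the property that some `F_x` fits between `s` and `A`; for `s = A` this
    -- is equality.
    refine hA.1.isCompact.induction_on (p := fun s => ∃ x : D,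
      s ⊆ {F : PrimaryFilter D | x ∈ F.1} ∧ {F : PrimaryFilter D | x ∈ F.1} ⊆ A) ?_ ?_ ?_ ?_
    · exact ⟨⊥, Set.empty_subset _, fun F hF => (F.2.bot_notMem hF).elim⟩
    · rintro s t hst ⟨x, hx, hxA⟩
      exact ⟨x, hst.trans hx, hxA⟩
    · rintro s t ⟨x, hx, hxA⟩ ⟨y, hy, hyA⟩
      refine ⟨neg (neg x ⊓ neg y), ?_, fun F hF => ?_⟩
      · rintro F (h | h)
        · exact F.2.neg_mem_iff.2 fun h' =>
            F.2.neg_mem_iff.1 (F.2.isFilter.inf_mem_iff.1 h').1 (hx h)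
        · exact F.2.neg_mem_iff.2 fun h' =>
            F.2.neg_mem_iff.1 (F.2.isFilter.inf_mem_iff.1 h').2 (hy h)
      · by_cases h : x ∈ F.1
        · exact hxA h
        · by_cases h' : y ∈ F.1
          · exact hyA h'
          · exact (F.2.neg_mem_iff.1 hF (F.2.isFilter.inf_mem _ (F.2.neg_mem_iff.2 h) _
              (F.2.neg_mem_iff.2 h'))).elim
    · intro F hF
      obtain ⟨t, ht, hFt, htA⟩ := hbasis.mem_nhds_iff.1 (hA.2.mem_nhds hF)
      rcases ht with rfl | ⟨x, rfl⟩
      · exact ⟨Set.univ, Filter.univ_mem, ⊤, fun F _ => F.2.top_mem, fun F _ => htA trivial⟩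
      · have he : {F : PrimaryFilter D | neg x ∈ F.1} = {F : PrimaryFilter D | x ∈ F.1}ᶜ := by
          ext F
          exact F.2.neg_mem_iff
        refine ⟨{F : PrimaryFilter D | x ∈ F.1}ᶜ, mem_nhdsWithin_of_mem_nhds
          ((isClopen_setOf_mem_primaryFilter x).compl.2.mem_nhds hFt), neg x, he.ge, he.le.trans htA⟩
  refine ⟨x ⊓ x, inf_idem_inf _ _, (hx.1.antisymm hx.2).trans ?_⟩
  ext F
  simp [F.2.isFilter.inf_mem_iff]

/-! ### The topology of primary ideals -/

/-- Primary ideals are the primary filters of the dual algebra. -/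
def primaryIdealHomeomorph (D : Type u) [DoubleBooleanAlgebra D] :
    PrimaryIdeal D ≃ₜ PrimaryFilter (Dual D) where
  toFun I := ⟨I.1, isPrimaryFilter_dual_iff.2 I.2⟩
  invFun F := ⟨F.1, isPrimaryFilter_dual_iff.1 F.2⟩
  left_inv _ := rfl
  right_inv _ := rfl
  continuous_toFun := continuous_generateFrom_iff.2 (by
    rintro _ ⟨x, rfl⟩
    exact TopologicalSpace.isOpen_generateFrom_of_mem ⟨x, rfl⟩)
  continuous_invFun := continuous_generateFrom_iff.2 (by
    rintro _ ⟨x, rfl⟩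
    exact TopologicalSpace.isOpen_generateFrom_of_mem ⟨x, rfl⟩)

theorem isClopen_setOf_mem_primaryIdeal (x : D) : IsClopen {I : PrimaryIdeal D | x ∈ I.1} :=
  (isClopen_setOf_mem_primaryFilter (D := Dual D) x).preimage (primaryIdealHomeomorph D).continuous

instance : CompactSpace (PrimaryIdeal D) := (primaryIdealHomeomorph D).symm.compactSpace

instance : TotallySeparatedSpace (PrimaryIdeal D) := by
  refine totallySeparatedSpace_iff_exists_isClopen.2 fun I J hne => ?_
  obtain ⟨U, hU, h1, h2⟩ :=
    exists_isClopen_of_totally_separated ((primaryIdealHomeomorph D).injective.ne hne)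
  exact ⟨_, hU.preimage (primaryIdealHomeomorph D).continuous, h1, h2⟩

theorem exists_eq_setOf_mem_primaryIdeal {B : Set (PrimaryIdeal D)} (hB : IsClopen B) :
    ∃ x : D, x ⊔ x = x ∧ B = {I : PrimaryIdeal D | x ∈ I.1} := by
  obtain ⟨x, hx, h⟩ := exists_eq_setOf_mem_primaryFilter (D := Dual D)
    (hB.preimage (primaryIdealHomeomorph D).symm.continuous)
  refine ⟨x, hx, ?_⟩
  ext I
  exact Set.ext_iff.1 h (primaryIdealHomeomorph D I)

end DoubleBooleanAlgebra

/-! ### Contexts on Stone spaces -/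

/-- Clopen sets suffice as tests: they form a basis of `Y` (lower part), and one fits between the
closed set `f x` and any open set containing it (upper part). -/
theorem lowerHemicontinuous_and_upperHemicontinuous_of_isClopen {X Y : Type*}
    [TopologicalSpace X] [TopologicalSpace Y] [CompactSpace Y] [TotallySeparatedSpace Y]
    {f : X → Set Y} (hf : ∀ x, IsClosed (f x))
    (h : ∀ B, IsClopen B → IsClopen {x | (f x ∩ B).Nonempty}) :
    LowerHemicontinuous f ∧ UpperHemicontinuous f := by
  constructor
  · refine lowerHemicontinuous_iff_isOpen_inter_nonempty.2 fun U hU => isOpen_iff_mem_nhds.2 ?_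
    rintro x ⟨y, hy, hyU⟩
    obtain ⟨B, hB, hyB, hBU⟩ := compact_exists_isClopen_in_isOpen hU hyU
    filter_upwards [(h B hB).2.mem_nhds ⟨y, hy, hyB⟩] with x' hx'
    exact hx'.mono (Set.inter_subset_inter_right _ hBU)
  · refine upperHemicontinuous_iff_forall_isOpen.2 fun x U hU hxU => ?_
    obtain ⟨B, hB, hxB, hBU⟩ := exists_clopen_of_closed_subset_open (hf x) hU hxU
    have hx : x ∈ {x | (f x ∩ Bᶜ).Nonempty}ᶜ := by
      rintro ⟨y, hy, hyB⟩
      exact hyB (hxB hy)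
    filter_upwards [(h _ hB.compl).compl.2.mem_nhds hx] with x' hx' y hy
    by_contra hyU
    exact hx' ⟨y, hy, fun hyB => hyU (hBU hyB)⟩

namespace CTS

variable {K : CTS.{u}}

/-- The Galois connection between `◇` and `■`, from which the identities below follow formally. -/
theorem diamond_subset_iff {A : Set K.G} {B : Set K.M} :
    K.diamond B ⊆ A ↔ B ⊆ K.blackBox A :=
  ⟨fun h m hm _ hg => h ⟨m, hg, hm⟩, fun h _ ⟨_, hg, hm⟩ => h hm hg⟩

theorem diamond_blackBox_subset (A : Set K.G) : K.diamond (K.blackBox A) ⊆ A :=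
  diamond_subset_iff.2 subset_rfl

theorem subset_blackBox_diamond (B : Set K.M) : B ⊆ K.blackBox (K.diamond B) :=
  diamond_subset_iff.1 subset_rfl

theorem diamond_mono {B C : Set K.M} (h : B ⊆ C) : K.diamond B ⊆ K.diamond C :=
  fun _ => Set.Nonempty.mono (Set.inter_subset_inter_right _ h)

theorem blackBox_mono {A C : Set K.G} (h : A ⊆ C) : K.blackBox A ⊆ K.blackBox C :=
  fun _ hm => Set.Subset.trans hm h

theorem diamond_blackBox_diamond (B : Set K.M) :
    K.diamond (K.blackBox (K.diamond B)) = K.diamond B :=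
  (diamond_blackBox_subset _).antisymm (diamond_mono (subset_blackBox_diamond B))

theorem blackBox_diamond_blackBox (A : Set K.G) :
    K.blackBox (K.diamond (K.blackBox A)) = K.blackBox A :=
  (blackBox_mono (diamond_blackBox_subset A)).antisymm (subset_blackBox_diamond _)

theorem IsClopenSemiconcept.diamond_subset {A : Set K.G} {B : Set K.M}
    (h : K.IsClopenSemiconcept A B) : K.diamond B ⊆ A := by
  rcases h.semiconcept with h | h
  · exact h ▸ diamond_blackBox_subset A
  · exact h.le

/-- Lower semi-continuity of the converse gives closedness and upper semi-continuity gives openness.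
For `◇`, which uses `R` itself, the two roles are exchanged. -/
theorem IsCTSCR.isClopen_blackBox (hK : K.IsCTSCR) {A : Set K.G} (hA : IsClopen A) :
    IsClopen (K.blackBox A) := by
  refine ⟨⟨?_⟩, ?_⟩
  · convert lowerHemicontinuous_iff_isOpen_inter_nonempty.1 hK.lower_inv Aᶜ hA.compl.2 using 1
    ext m
    exact Set.not_subset
  · exact upperHemicontinuous_iff_isOpen_preimage_Iic.1 hK.upper_inv A hA.2

theorem IsCTSCR.isClopen_diamond (hK : K.IsCTSCR) {B : Set K.M} (hB : IsClopen B) :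
    IsClopen (K.diamond B) := by
  refine ⟨⟨?_⟩, lowerHemicontinuous_iff_isOpen_inter_nonempty.1 hK.lower B hB.2⟩
  convert upperHemicontinuous_iff_isOpen_preimage_Iic.1 hK.upper Bᶜ hB.compl.2 using 1
  ext g
  exact Set.not_nonempty_iff_eq_empty.trans Set.disjoint_iff_inter_eq_empty.symm
    |>.trans Set.subset_compl_iff_disjoint_right.symm

/-- Semi-continuity can be tested on clopen sets once `R(g)` and `R⁻¹(m)` are closed. They are,
since `hrel` presents them as intersections of clopen sets taken from semiconcepts. -/
theorem isStoneContext_of_isClopen [CompactSpace K.G] [TotallySeparatedSpace K.G]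
    [CompactSpace K.M] [TotallySeparatedSpace K.M]
    (hbox : ∀ A, IsClopen A → IsClopen (K.blackBox A))
    (hdia : ∀ B, IsClopen B → IsClopen (K.diamond B))
    (hrel : ∀ (g : K.G) (m : K.M),
      (∀ (A : Set K.G) (B : Set K.M), K.IsClopenSemiconcept A B → m ∈ B → g ∈ A) → K.R g m) :
    K.IsStoneContext := by
  have hiff : ∀ g m, K.R g m ↔
      ∀ p : {p : Set K.G × Set K.M // K.IsClopenSemiconcept p.1 p.2}, m ∈ p.1.2 → g ∈ p.1.1 :=
    fun g m => ⟨fun h p hm => p.2.diamond_subset ⟨m, h, hm⟩,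
      fun h => hrel g m fun A B hAB => h ⟨(A, B), hAB⟩⟩
  have himage : ∀ g, IsClosed (K.image g) := fun g => by
    have : K.image g = ⋂ p : {p : {p : Set K.G × Set K.M // K.IsClopenSemiconcept p.1 p.2} //
        g ∉ p.1.1}, p.1.1.2ᶜ := by
      ext m
      rw [Set.mem_iInter]
      exact (hiff g m).trans ⟨fun h p hm => p.2 (h _ hm),
        fun h p hm => by_contra fun hg => h ⟨p, hg⟩ hm⟩
    rw [this]
    exact isClosed_iInter fun p => p.1.2.clopen_snd.compl.1
  have hfiber : ∀ m, IsClosed (K.fiber m) := fun m => by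
    have : K.fiber m = ⋂ p : {p : {p : Set K.G × Set K.M // K.IsClopenSemiconcept p.1 p.2} //
        m ∈ p.1.2}, p.1.1.1 := by
      ext g
      rw [Set.mem_iInter]
      exact (hiff g m).trans ⟨fun h p => h _ p.2, fun h p hm => h ⟨p, hm⟩⟩
    rw [this]
    exact isClosed_iInter fun p => p.1.2.clopen_fst.1
  have h1 := lowerHemicontinuous_and_upperHemicontinuous_of_isClopen himage hdia
  have h2 := lowerHemicontinuous_and_upperHemicontinuous_of_isClopen hfiber fun A hA => by
    convert (hbox _ hA.compl).compl using 1
    ext m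
    have := Set.inter_compl_nonempty_iff (s := K.fiber m) (t := Aᶜ)
    rwa [compl_compl] at this
  exact ⟨⟨h1.1, h1.2, h2.1, h2.2⟩, inferInstance, inferInstance, inferInstance, inferInstance, hrel⟩

end CTS

theorem CTS.IsHomeo.preimage_blackBox {K L : CTS.{u}} {α : K.G → L.G} {β : K.M → L.M}
    (h : CTS.IsHomeo K L α β) (A : Set L.G) : K.blackBox (α ⁻¹' A) = β ⁻¹' L.blackBox A := by
  ext m
  refine ⟨fun hm g hg => ?_, fun hm g hg => hm ((h.rel_iff g m).1 hg)⟩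
  obtain ⟨g, rfl⟩ := h.homeo_fst.surjective g
  exact hm ((h.rel_iff g m).2 hg)

theorem CTS.IsHomeo.preimage_diamond {K L : CTS.{u}} {α : K.G → L.G} {β : K.M → L.M}
    (h : CTS.IsHomeo K L α β) (B : Set L.M) : K.diamond (β ⁻¹' B) = α ⁻¹' L.diamond B := by
  ext g
  refine ⟨fun ⟨m, hm, hB⟩ => ⟨β m, (h.rel_iff g m).1 hm, hB⟩, fun ⟨m, hm, hB⟩ => ?_⟩
  obtain ⟨m, rfl⟩ := h.homeo_snd.surjective m
  exact ⟨m, (h.rel_iff g m).2 hm, hB⟩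

theorem CTS.IsHomeo.exists_inverse {K L : CTS.{u}} {α : K.G → L.G} {β : K.M → L.M}
    (h : CTS.IsHomeo K L α β) : ∃ (a : L.G → K.G) (b : L.M → K.M), CTS.IsHomeo L K a b ∧
      Function.LeftInverse a α ∧ Function.RightInverse a α ∧
      Function.LeftInverse b β ∧ Function.RightInverse b β := by
  obtain ⟨hα, a, hal, har, ha⟩ := isHomeomorph_iff_exists_inverse.1 h.homeo_fst
  obtain ⟨hβ, b, hbl, hbr, hb⟩ := isHomeomorph_iff_exists_inverse.1 h.homeo_snd
  refine ⟨a, b, ⟨fun g m => ?_, isHomeomorph_iff_exists_inverse.2 ⟨ha, _, har, hal, hα⟩,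
    isHomeomorph_iff_exists_inverse.2 ⟨hb, _, hbr, hbl, hβ⟩⟩, hal, har, hbl, hbr⟩
  rw [h.rel_iff, har, hbr]

theorem CTS.IsHomeo.isClopenSemiconcept_preimage {K L : CTS.{u}} {α : K.G → L.G} {β : K.M → L.M}
    (h : CTS.IsHomeo K L α β) {A : Set L.G} {B : Set L.M} (hAB : L.IsClopenSemiconcept A B) :
    K.IsClopenSemiconcept (α ⁻¹' A) (β ⁻¹' B) where
  semiconcept := hAB.semiconcept.imp (fun hA => (h.preimage_blackBox A).trans (by rw [hA]))
    fun hB => (h.preimage_diamond B).trans (by rw [hB])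
  clopen_fst := hAB.clopen_fst.preimage h.homeo_fst.continuous
  clopen_snd := hAB.clopen_snd.preimage h.homeo_snd.continuous

/-! ### The context of primary filters and primary ideals -/

section PrimaryContext

variable {D E : Type u} [DoubleBooleanAlgebra D] [DoubleBooleanAlgebra E]

/-- Idempotence turns the condition `x ⊓ x ∉ I` of `exists_disjoint` into `x ∉ I`, so an ideal
without `x` misses some primary filter containing `x`. -/
theorem primaryContext_blackBox {x : D} (hx : x ⊓ x = x) :
    (primaryContext D).blackBox {F : PrimaryFilter D | x ∈ F.1}ᶜ =
      {I : PrimaryIdeal D | x ∈ I.1} := by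
  ext I
  refine ⟨fun h => ?_, fun h F hF hxF => Set.notMem_empty x (hF.le ⟨hxF, h⟩)⟩
  by_contra hxI
  obtain ⟨F, hF, hxF, hd⟩ := I.2.exists_disjoint (x := x) (by rwa [hx])
  exact h (show (⟨F, hF⟩ : PrimaryFilter D) ∈ _ from hd) hxF

theorem primaryContext_diamond {x : D} (hx : x ⊔ x = x) :
    (primaryContext D).diamond {I : PrimaryIdeal D | x ∈ I.1} =
      {F : PrimaryFilter D | x ∈ F.1}ᶜ := by
  ext F
  refine ⟨fun ⟨I, hI, hxI⟩ hxF => Set.notMem_empty x (hI.le ⟨hxF, hxI⟩), fun h => ?_⟩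
  obtain ⟨I, hI, hxI, hd⟩ := F.2.exists_disjoint (x := x) (by rwa [hx])
  exact ⟨⟨I, hI⟩, hd, hxI⟩

/-- The two cases of purity match the two alternatives in the definition of a semiconcept. -/
theorem isClopenSemiconcept_primaryContext (hD : IsPure D) (x : D) :
    (primaryContext D).IsClopenSemiconcept {F : PrimaryFilter D | x ∈ F.1}ᶜ
      {I : PrimaryIdeal D | x ∈ I.1} where
  semiconcept := (hD x).imp primaryContext_blackBox primaryContext_diamond
  clopen_fst := (isClopen_setOf_mem_primaryFilter x).compl
  clopen_snd := isClopen_setOf_mem_primaryIdeal x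

theorem isStoneContext_primaryContext (hD : IsPure D) : (primaryContext D).IsStoneContext := by
  have : CompactSpace (primaryContext D).G := inferInstanceAs (CompactSpace (PrimaryFilter D))
  have : CompactSpace (primaryContext D).M := inferInstanceAs (CompactSpace (PrimaryIdeal D))
  have : TotallySeparatedSpace (primaryContext D).G :=
    inferInstanceAs (TotallySeparatedSpace (PrimaryFilter D))
  have : TotallySeparatedSpace (primaryContext D).M :=
    inferInstanceAs (TotallySeparatedSpace (PrimaryIdeal D))
  refine CTS.isStoneContext_of_isClopen (fun A hA => ?_) (fun B hB => ?_) fun F I h => ?_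
  · obtain ⟨x, hx, h⟩ := exists_eq_setOf_mem_primaryFilter (D := D) hA.compl
    rw [← compl_compl A, h]
    exact (primaryContext_blackBox hx).symm ▸ isClopen_setOf_mem_primaryIdeal x
  · obtain ⟨x, hx, rfl⟩ := exists_eq_setOf_mem_primaryIdeal (D := D) hB
    exact (primaryContext_diamond hx).symm ▸ (isClopen_setOf_mem_primaryFilter x).compl
  · exact Set.eq_empty_of_forall_notMem fun x hx =>
      h _ _ (isClopenSemiconcept_primaryContext hD x) hx.2 hx.1

/-- In a pure algebra, an element is determined by the primary filters and the primary ideals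
that contain it. -/
theorem eq_of_forall_mem_iff (hD : IsPure D) {x y : D}
    (hF : ∀ F : Set D, IsPrimaryFilter F → (x ∈ F ↔ y ∈ F))
    (hI : ∀ I : Set D, IsPrimaryIdeal I → (x ∈ I ↔ y ∈ I)) : x = y := by
  have h1 := inf_self_eq_of_forall hF
  have h2 := sup_self_eq_of_forall hI
  rcases hD x with hx | hx <;> rcases hD y with hy | hy
  · rw [← hx, h1, hy]
  -- In the mixed cases the axiom linking the two halves is decisive: here it makes `x ⊔ x = y` a
  -- `⊓`-idempotent, so `y = y ⊓ y = x ⊓ x = x`.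
  · have h := inf_sup_self x
    rw [hx, h2, hy, ← h1, hx] at h
    exact h.symm
  · have h := inf_sup_self y
    rw [hy, ← h2, hx, h1, hy] at h
    exact h
  · rw [← hx, h2, hy]

theorem DoubleBooleanAlgebra.IsDBAIso.exists_inverse {f : D → E} (hf : IsDBAIso f) :
    ∃ g : E → D, IsDBAIso g ∧ Function.LeftInverse g f ∧ Function.RightInverse g f := by
  obtain ⟨g, hl, hr⟩ := Function.bijective_iff_has_inverse.1 hf.bijective
  refine ⟨g, ⟨⟨fun a b => ?_, fun a b => ?_, fun a => ?_, fun a => ?_, ?_, ?_⟩,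
    hr.injective, hl.surjective⟩, hl, hr⟩ <;> apply hf.bijective.1
  · rw [hf.isHom.map_inf, hr, hr, hr]
  · rw [hf.isHom.map_sup, hr, hr, hr]
  · rw [hf.isHom.map_neg, hr, hr]
  · rw [hf.isHom.map_opp, hr, hr]
  · rw [hf.isHom.map_top, hr]
  · rw [hf.isHom.map_bot, hr]

theorem isHomeo_of_isDBAIso {f : D → E} (hf : IsDBAIso f) :
    CTS.IsHomeo (primaryContext E) (primaryContext D) (alphaMap hf.isHom) (betaMap hf.isHom) := by
  obtain ⟨g, hg, hl, hr⟩ := hf.exists_inverse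
  have hα : ∀ {D E : Type u} [DoubleBooleanAlgebra D] [DoubleBooleanAlgebra E] {f : D → E}
      (hf : IsHom f), Continuous (alphaMap hf) := fun {D E} _ _ {f} hf =>
    continuous_generateFrom_iff.2 (by
      rintro _ ⟨x, rfl⟩
      exact TopologicalSpace.isOpen_generateFrom_of_mem ⟨f x, rfl⟩)
  have hβ : ∀ {D E : Type u} [DoubleBooleanAlgebra D] [DoubleBooleanAlgebra E] {f : D → E}
      (hf : IsHom f), Continuous (betaMap hf) := fun {D E} _ _ {f} hf =>
    continuous_generateFrom_iff.2 (by
      rintro _ ⟨x, rfl⟩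
      exact TopologicalSpace.isOpen_generateFrom_of_mem ⟨f x, rfl⟩)
  refine ⟨fun F I => ?_, ?_, ?_⟩
  · change F.1 ∩ I.1 = ∅ ↔ f ⁻¹' F.1 ∩ f ⁻¹' I.1 = ∅
    rw [← Set.preimage_inter, Set.preimage_eq_empty_iff, hf.bijective.2.range_eq,
      Set.disjoint_univ]
  · exact isHomeomorph_iff_exists_inverse.2 ⟨hα _, alphaMap hg.isHom,
      fun F => Subtype.ext (by
        change g ⁻¹' (f ⁻¹' F.1) = F.1
        rw [← Set.preimage_comp, hr.comp_eq_id, Set.preimage_id]),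
      fun F => Subtype.ext (by
        change f ⁻¹' (g ⁻¹' F.1) = F.1
        rw [← Set.preimage_comp, hl.comp_eq_id, Set.preimage_id]), hα _⟩
  · exact isHomeomorph_iff_exists_inverse.2 ⟨hβ _, betaMap hg.isHom,
      fun F => Subtype.ext (by
        change g ⁻¹' (f ⁻¹' F.1) = F.1
        rw [← Set.preimage_comp, hr.comp_eq_id, Set.preimage_id]),
      fun F => Subtype.ext (by
        change f ⁻¹' (g ⁻¹' F.1) = F.1
        rw [← Set.preimage_comp, hl.comp_eq_id, Set.preimage_id]), hβ _⟩

end PrimaryContext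

/-! ### The algebra of clopen semiconcepts -/

namespace Scxt

variable {K L : Scxt.{u}}

/-- The clopen object oriented semiconcepts of a Stone context. -/
def ClopenSemiconcept (K : Scxt.{u}) : Type u :=
  {p : Set K.toCTS.G × Set K.toCTS.M // K.toCTS.IsClopenSemiconcept p.1 p.2}

namespace ClopenSemiconcept

/-- The set of objects of a clopen semiconcept. -/
def fst (p : K.ClopenSemiconcept) : Set K.toCTS.G := p.1.1

/-- The set of properties of a clopen semiconcept. -/
def snd (p : K.ClopenSemiconcept) : Set K.toCTS.M := p.1.2

theorem isClopen_fst (p : K.ClopenSemiconcept) : IsClopen p.fst := p.2.clopen_fst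

theorem isClopen_snd (p : K.ClopenSemiconcept) : IsClopen p.snd := p.2.clopen_snd

theorem ext {p q : K.ClopenSemiconcept} (h1 : p.fst = q.fst) (h2 : p.snd = q.snd) : p = q :=
  Subtype.ext (Prod.ext h1 h2)

theorem diamond_subset (p : K.ClopenSemiconcept) : K.toCTS.diamond p.snd ⊆ p.fst :=
  p.2.diamond_subset

theorem subset_blackBox (p : K.ClopenSemiconcept) : p.snd ⊆ K.toCTS.blackBox p.fst :=
  CTS.diamond_subset_iff.1 p.diamond_subset

/-- The semiconcept `(A, A^■)`. -/
def ofFst (A : Set K.toCTS.G) (hA : IsClopen A) : K.ClopenSemiconcept :=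
  ⟨(A, K.toCTS.blackBox A), Or.inl rfl, hA, K.isStoneContext.isCTSCR.isClopen_blackBox hA⟩

/-- The semiconcept `(B^◇, B)`. -/
def ofSnd (B : Set K.toCTS.M) (hB : IsClopen B) : K.ClopenSemiconcept :=
  ⟨(K.toCTS.diamond B, B), Or.inr rfl, K.isStoneContext.isCTSCR.isClopen_diamond hB, hB⟩

theorem ofFst_congr {A C : Set K.toCTS.G} (hA : IsClopen A) (hC : IsClopen C) (h : A = C) :
    ofFst A hA = ofFst C hC := by
  subst h
  rfl

theorem ofSnd_congr {A C : Set K.toCTS.M} (hA : IsClopen A) (hC : IsClopen C) (h : A = C) :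
    ofSnd A hA = ofSnd C hC := by
  subst h
  rfl

/-- The operations imitate `x ↦ (F_xᶜ, I_x)`, under which `⊓` becomes union of first components and
`⊔` intersection of second ones. -/
instance : Min K.ClopenSemiconcept :=
  ⟨fun p q => ofFst (p.fst ∪ q.fst) (p.isClopen_fst.union q.isClopen_fst)⟩

instance : Max K.ClopenSemiconcept :=
  ⟨fun p q => ofSnd (p.snd ∩ q.snd) (p.isClopen_snd.inter q.isClopen_snd)⟩

/-- The semiconcepts form a double Boolean algebra, ordered by reverse inclusion. -/
instance : DoubleBooleanAlgebra K.ClopenSemiconcept where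
  top := ofSnd ∅ isClopen_empty
  bot := ofFst Set.univ isClopen_univ
  neg p := ofFst p.fstᶜ p.isClopen_fst.compl
  opp p := ofSnd p.sndᶜ p.isClopen_snd.compl
  inf_self_inf x y := ofFst_congr _ _ (congrArg (· ∪ y.fst) (Set.union_self x.fst))
  inf_comm' x y := ofFst_congr _ _ (Set.union_comm _ _)
  inf_assoc' x y z := ofFst_congr _ _ (Set.union_assoc _ _ _).symm
  neg_inf_self x := ofFst_congr _ _ (congrArg compl (Set.union_self x.fst))
  inf_sup_absorb x y := ofFst_congr _ _ (by
    change x.fst ∪ K.toCTS.diamond (x.snd ∩ y.snd) = x.fst ∪ x.fst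
    rw [Set.union_self, Set.union_eq_left]
    exact (CTS.diamond_mono Set.inter_subset_left).trans x.diamond_subset)
  inf_vee x y z := ofFst_congr _ _ (by
    change x.fst ∪ (y.fstᶜ ∪ z.fstᶜ)ᶜ = ((x.fst ∪ y.fst)ᶜ ∪ (x.fst ∪ z.fst)ᶜ)ᶜ
    rw [← Set.compl_inter, compl_compl, ← Set.compl_inter, compl_compl,
      Set.union_inter_distrib_left])
  inf_vee_absorb x y := ofFst_congr _ _ (by
    change x.fst ∪ (x.fstᶜ ∪ y.fstᶜ)ᶜ = x.fst ∪ x.fst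
    rw [← Set.compl_inter, compl_compl, Set.union_self, Set.union_eq_left]
    exact Set.inter_subset_left)
  neg_neg_inf x y := ofFst_congr _ _ (compl_compl (x.fst ∪ y.fst))
  inf_neg x := ofFst_congr _ _ (Set.union_compl_self x.fst)
  neg_bot := ofFst_congr _ _ (by
    change Set.univᶜ = K.toCTS.diamond ∅ ∪ K.toCTS.diamond ∅
    simp [CTS.diamond])
  neg_top := ofFst_congr _ _ (by
    change (K.toCTS.diamond ∅)ᶜ = Set.univ
    simp [CTS.diamond])
  sup_self_sup x y := ofSnd_congr _ _ (congrArg (· ∩ y.snd) (Set.inter_self x.snd))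
  sup_comm' x y := ofSnd_congr _ _ (Set.inter_comm _ _)
  sup_assoc' x y z := ofSnd_congr _ _ (Set.inter_assoc _ _ _).symm
  opp_sup_self x := ofSnd_congr _ _ (congrArg compl (Set.inter_self x.snd))
  sup_inf_absorb x y := ofSnd_congr _ _ (by
    change x.snd ∩ K.toCTS.blackBox (x.fst ∪ y.fst) = x.snd ∩ x.snd
    rw [Set.inter_self, Set.inter_eq_left]
    exact x.subset_blackBox.trans (CTS.blackBox_mono Set.subset_union_left))
  sup_wedge x y z := ofSnd_congr _ _ (by
    change x.snd ∩ (y.sndᶜ ∩ z.sndᶜ)ᶜ = ((x.snd ∩ y.snd)ᶜ ∩ (x.snd ∩ z.snd)ᶜ)ᶜ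
    rw [← Set.compl_union, compl_compl, ← Set.compl_union, compl_compl,
      Set.inter_union_distrib_left])
  sup_wedge_absorb x y := ofSnd_congr _ _ (by
    change x.snd ∩ (x.sndᶜ ∩ y.sndᶜ)ᶜ = x.snd ∩ x.snd
    rw [← Set.compl_union, compl_compl, Set.inter_self, Set.inter_eq_left]
    exact Set.subset_union_left)
  opp_opp_sup x y := ofSnd_congr _ _ (compl_compl (x.snd ∩ y.snd))
  sup_opp x := ofSnd_congr _ _ (Set.inter_compl_self x.snd)
  opp_top := ofSnd_congr _ _ (by
    change ∅ᶜ = K.toCTS.blackBox Set.univ ∩ K.toCTS.blackBox Set.univ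
    simp [CTS.blackBox])
  opp_bot := ofSnd_congr _ _ (by
    change (K.toCTS.blackBox Set.univ)ᶜ = ∅
    simp [CTS.blackBox])
  -- For `x = (A, B)` the sides are `(A^■^◇, A^■)` and `(B^◇, B^◇^■)`. They agree if `A^■ = B` or
  -- `B^◇ = A`, by the Galois identities.
  inf_sup_self x := by
    refine ext ?_ ?_
    · change K.toCTS.diamond (K.toCTS.blackBox (x.fst ∪ x.fst) ∩ K.toCTS.blackBox (x.fst ∪ x.fst)) =
        K.toCTS.diamond (x.snd ∩ x.snd) ∪ K.toCTS.diamond (x.snd ∩ x.snd)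
      rw [Set.union_self, Set.inter_self, Set.inter_self, Set.union_self]
      rcases x.2.semiconcept with h | h
      · exact congrArg _ h
      · change K.toCTS.diamond x.snd = x.fst at h
        rw [← h, CTS.diamond_blackBox_diamond]
    · change K.toCTS.blackBox (x.fst ∪ x.fst) ∩ K.toCTS.blackBox (x.fst ∪ x.fst) =
        K.toCTS.blackBox (K.toCTS.diamond (x.snd ∩ x.snd) ∪ K.toCTS.diamond (x.snd ∩ x.snd))
      rw [Set.union_self, Set.inter_self, Set.inter_self, Set.union_self]
      rcases x.2.semiconcept with h | h
      · change K.toCTS.blackBox x.fst = x.snd at h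
        rw [← h, CTS.blackBox_diamond_blackBox]
      · exact congrArg _ h.symm

theorem fst_inf (p q : K.ClopenSemiconcept) : (p ⊓ q).fst = p.fst ∪ q.fst := rfl

theorem snd_sup (p q : K.ClopenSemiconcept) : (p ⊔ q).snd = p.snd ∩ q.snd := rfl

theorem isPure : IsPure K.ClopenSemiconcept := fun p => by
  refine p.2.semiconcept.imp (fun h => ext (Set.union_self _) ?_)
    fun h => ext ?_ (Set.inter_self _)
  · exact (congrArg _ (Set.union_self _)).trans h
  · exact (congrArg _ (Set.inter_self _)).trans h

theorem fst_subset_of_qle {p q : K.ClopenSemiconcept} (h : QLe p q) : q.fst ⊆ p.fst := by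
  have := congrArg fst h.1
  rwa [fst_inf, fst_inf, Set.union_self, Set.union_eq_left] at this

theorem snd_subset_of_qle {p q : K.ClopenSemiconcept} (h : QLe p q) : q.snd ⊆ p.snd := by
  have := congrArg snd h.2
  rwa [snd_sup, snd_sup, Set.inter_self, Set.inter_eq_right] at this

end ClopenSemiconcept

open ClopenSemiconcept

/-- The primary filter of the semiconcepts whose set of objects avoids `g`. -/
def filterOf (g : K.toCTS.G) : PrimaryFilter K.ClopenSemiconcept :=
  ⟨{p | g ∉ p.fst}, ⟨fun _ hx _ hy h => h.elim hx hy,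
    fun _ hx _ hz h => hx (fst_subset_of_qle hz h)⟩,
    fun h => (h.ge (Set.mem_univ ⊥) : g ∉ Set.univ) trivial, fun p => (em (g ∈ p.fst)).symm.imp id
      fun h => not_not.2 h⟩

/-- The primary ideal of the semiconcepts whose set of properties contains `m`. -/
def idealOf (m : K.toCTS.M) : PrimaryIdeal K.ClopenSemiconcept :=
  ⟨{p | m ∈ p.snd}, ⟨fun _ hx _ hy => ⟨hx, hy⟩, fun _ hx _ hz => snd_subset_of_qle hz hx⟩,
    fun h => (h.ge (Set.mem_univ ⊤) : m ∈ (∅ : Set K.toCTS.M)), fun p => em (m ∈ p.snd)⟩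

/-- A continuous bijection from a compact space to a Hausdorff space. Points are separated by
semiconcepts `(U, U^■)`. For surjectivity, the complements of the `p.fst` with `p ∈ F` are directed,
closed and nonempty, so they share a point `g`; `neg` upgrades `F ⊆ filterOf g` to equality. -/
theorem isHomeomorph_filterOf : IsHomeomorph (filterOf (K := K)) := by
  have := K.isStoneContext.compact_G
  have := K.isStoneContext.separated_G
  refine isHomeomorph_iff_continuous_bijective.2
    ⟨continuous_generateFrom_iff.2 ?_, fun g g' h => ?_, fun F => ?_⟩
  · rintro _ ⟨p, rfl⟩
    convert p.isClopen_fst.2 using 1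
    ext g
    exact not_not
  · by_contra hne
    obtain ⟨U, hU, h1, h2⟩ := exists_isClopen_of_totally_separated hne
    exact (Set.ext_iff.1 (congrArg Subtype.val h) (ofFst U hU)).2 h2 h1
  · have : Nonempty F.1 := ⟨⟨⊤, F.2.top_mem⟩⟩
    obtain ⟨g, hg⟩ := IsCompact.nonempty_iInter_of_directed_nonempty_isCompact_isClosed
      (fun p : F.1 => p.1.fstᶜ) (fun p q => ⟨⟨p.1 ⊓ q.1, F.2.isFilter.inf_mem _ p.2 _ q.2⟩,
        Set.compl_subset_compl.2 Set.subset_union_left,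
        Set.compl_subset_compl.2 Set.subset_union_right⟩)
      -- If `p.fst` were everything, `p ⊓ p` would be `⊥`.
      (fun p => Set.nonempty_compl.2 fun h => F.2.bot_notMem (by
        convert F.2.isFilter.inf_mem _ p.2 _ p.2 using 1
        refine (ofFst_congr _ _ ?_).symm
        rw [h, Set.union_self]))
      (fun p => p.1.isClopen_fst.compl.1.isCompact) (fun p => p.1.isClopen_fst.compl.1)
    rw [Set.mem_iInter] at hg
    refine ⟨g, Subtype.ext (Set.ext fun p => ⟨fun h => ?_, fun h => hg ⟨p, h⟩⟩)⟩
    by_contra hp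
    exact hg ⟨neg p, F.2.neg_mem_iff.2 hp⟩ h

theorem isHomeomorph_idealOf : IsHomeomorph (idealOf (K := K)) := by
  have := K.isStoneContext.compact_M
  have := K.isStoneContext.separated_M
  refine isHomeomorph_iff_continuous_bijective.2
    ⟨continuous_generateFrom_iff.2 ?_, fun m m' h => ?_, fun I => ?_⟩
  · rintro _ ⟨p, rfl⟩
    exact p.isClopen_snd.compl.2
  · by_contra hne
    obtain ⟨U, hU, h1, h2⟩ := exists_isClopen_of_totally_separated hne
    exact h2 ((Set.ext_iff.1 (congrArg Subtype.val h) (ofSnd U hU)).1 h1)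
  · have : Nonempty I.1 := ⟨⟨⊥, I.2.bot_mem⟩⟩
    obtain ⟨m, hm⟩ := IsCompact.nonempty_iInter_of_directed_nonempty_isCompact_isClosed
      (fun p : I.1 => p.1.snd) (fun p q => ⟨⟨p.1 ⊔ q.1, I.2.isIdeal.sup_mem _ p.2 _ q.2⟩,
        Set.inter_subset_left, Set.inter_subset_right⟩)
      (fun p => Set.nonempty_iff_ne_empty.2 fun h => I.2.top_notMem (by
        convert I.2.isIdeal.sup_mem _ p.2 _ p.2 using 1
        refine (ofSnd_congr _ _ ?_).symm
        rw [h, Set.inter_self]))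
      (fun p => p.1.isClopen_snd.1.isCompact) (fun p => p.1.isClopen_snd.1)
    rw [Set.mem_iInter] at hm
    refine ⟨m, Subtype.ext (Set.ext fun p => ⟨fun h => ?_, fun h => hm ⟨p, h⟩⟩)⟩
    by_contra hp
    exact hm ⟨opp p, I.2.opp_mem_iff.2 hp⟩ h

/-- Disjointness of the filter of `g` and the ideal of `m` says that every clopen semiconcept `(A,
B)` with `m ∈ B` has `g ∈ A`, which is the condition defining Stone contexts. -/
theorem isHomeo_filterOf_idealOf (K : Scxt.{u}) :
    CTS.IsHomeo K.toCTS (primaryContext K.ClopenSemiconcept) filterOf idealOf where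
  rel_iff g m := by
    refine ⟨fun h => Set.eq_empty_of_forall_notMem fun p hp => hp.1 (p.diamond_subset ⟨m, h, hp.2⟩),
      fun h => K.isStoneContext.rel_of_forall g m fun A B hAB hm => ?_⟩
    by_contra hg
    exact Set.notMem_empty (⟨(A, B), hAB⟩ : K.ClopenSemiconcept) (h.le ⟨hg, hm⟩)
  homeo_fst := isHomeomorph_filterOf
  homeo_snd := isHomeomorph_idealOf

theorem isIso_of_hom (f : K ⟶ L) : IsIso f := by
  obtain ⟨a, b, hab, hal, har, hbl, hbr⟩ := (Hom.isHomeo f).exists_inverse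
  exact ⟨⟨a, b, hab⟩, Hom.ext hal.comp_eq_id hbl.comp_eq_id, Hom.ext har.comp_eq_id hbr.comp_eq_id⟩

end Scxt

/-! ### Isomorphisms from homeomorphisms of primary contexts -/

section Full

variable {D E : Type u} [DoubleBooleanAlgebra D] [DoubleBooleanAlgebra E]

/-- One component determines the other, and that component, being clopen, is represented by an
idempotent of the matching kind. -/
theorem exists_eq_of_isClopenSemiconcept {A : Set (PrimaryFilter D)} {B : Set (PrimaryIdeal D)}
    (h : (primaryContext D).IsClopenSemiconcept A B) :
    ∃ x : D, A = {F : PrimaryFilter D | x ∈ F.1}ᶜ ∧ B = {I : PrimaryIdeal D | x ∈ I.1} := by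
  rcases h.semiconcept with hs | hs
  · obtain ⟨x, hx, hA⟩ := exists_eq_setOf_mem_primaryFilter (D := D) h.clopen_fst.compl
    obtain rfl := compl_eq_comm.1 hA
    exact ⟨x, rfl, hs.symm.trans (primaryContext_blackBox hx)⟩
  · obtain ⟨x, hx, rfl⟩ := exists_eq_setOf_mem_primaryIdeal (D := D) h.clopen_snd
    exact ⟨x, hs.symm.trans (primaryContext_diamond hx), rfl⟩

/-- A map along which primary filters and primary ideals pull back, with disjointness reflected,
preserves the operations `⊓`, `neg` and `⊥`. -/
theorem map_inf_neg_bot_of_preimage (hE : IsPure E) {f : D → E}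
    (hF : ∀ F, IsPrimaryFilter F → IsPrimaryFilter (f ⁻¹' F))
    (hI : ∀ I, IsPrimaryIdeal I → IsPrimaryIdeal (f ⁻¹' I))
    (hsurj : ∀ F', IsPrimaryFilter F' → ∃ F, IsPrimaryFilter F ∧ f ⁻¹' F = F')
    (hrel : ∀ F I, IsPrimaryFilter F → IsPrimaryIdeal I → f ⁻¹' F ∩ f ⁻¹' I = ∅ → F ∩ I = ∅) :
    (∀ a b, f (a ⊓ b) = f a ⊓ f b) ∧ (∀ a, f (neg a) = neg (f a)) ∧ f ⊥ = ⊥ := by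
  -- Filters determine only `⊓`-parts, so `f` must first be shown to preserve `⊓`-idempotents. If an
  -- ideal `I` contained `f w ⊓ f w` but not `f w`, a primary filter containing `w` and disjoint
  -- from `f ⁻¹' I` would lift to one disjoint from `I` yet containing `f w ⊓ f w`.
  have hidem : ∀ w : D, w ⊓ w = w → f w ⊓ f w = f w := fun w hw =>
    eq_of_forall_mem_iff hE (fun F hF => by rw [hF.isFilter.inf_mem_iff, and_self]) fun I hI' => by
      refine ⟨fun h => ?_, fun h => hI'.isIdeal.mem_of_le _ h _ (inf_left_qle _ _)⟩
      by_contra hw'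
      obtain ⟨F', hF', hwF, hd⟩ := (hI I hI').exists_disjoint (x := w) (by rwa [hw])
      obtain ⟨F, hF, rfl⟩ := hsurj F' hF'
      exact Set.notMem_empty _ ((hrel F I hF hI' hd).le ⟨hF.isFilter.inf_mem _ hwF _ hwF, h⟩)
  refine ⟨fun a b => ?_, fun a => ?_, ?_⟩
  · rw [← hidem _ (inf_idem_inf a b), ← inf_idem_inf (f a)]
    refine inf_self_eq_of_forall fun F hF' => ?_
    rw [hF'.isFilter.inf_mem_iff]
    exact (hF F hF').isFilter.inf_mem_iff
  · rw [← hidem _ (neg_inf_idem a), ← neg_inf_idem (f a)]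
    refine inf_self_eq_of_forall fun F hF' => ?_
    rw [hF'.neg_mem_iff]
    exact (hF F hF').neg_mem_iff
  · rw [← hidem _ (inf_bot' ⊥), ← inf_bot' (⊥ : E)]
    exact inf_self_eq_of_forall fun F hF' => iff_of_false (hF F hF').bot_notMem
      fun h => hF'.bot_notMem (inf_bot' (⊥ : E) ▸ h)

/-- The semiconcept of `x` pulls back to a clopen semiconcept over `E`, which comes from an element.
-/
theorem exists_mem_iff_of_isHomeo (hD : IsPure D)
    {α : PrimaryFilter E → PrimaryFilter D} {β : PrimaryIdeal E → PrimaryIdeal D}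
    (h : CTS.IsHomeo (primaryContext E) (primaryContext D) α β) (x : D) :
    ∃ y : E, (∀ F, y ∈ F.1 ↔ x ∈ (α F).1) ∧ ∀ I, y ∈ I.1 ↔ x ∈ (β I).1 := by
  obtain ⟨y, hy1, hy2⟩ := exists_eq_of_isClopenSemiconcept
    (h.isClopenSemiconcept_preimage (isClopenSemiconcept_primaryContext hD x))
  exact ⟨y, fun F => (not_iff_not.1 (Set.ext_iff.1 hy1 F)).symm,
    fun I => (Set.ext_iff.1 hy2 I).symm⟩

theorem exists_isDBAIso_of_isHomeo (hD : IsPure D) (hE : IsPure E)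
    {α : PrimaryFilter E → PrimaryFilter D} {β : PrimaryIdeal E → PrimaryIdeal D}
    (h : CTS.IsHomeo (primaryContext E) (primaryContext D) α β) :
    ∃ (f : D → E) (hf : IsDBAIso f), alphaMap hf.isHom = α ∧ betaMap hf.isHom = β := by
  choose f hfα hfβ using exists_mem_iff_of_isHomeo hD h
  have hα : ∀ F : PrimaryFilter E, f ⁻¹' F.1 = (α F).1 := fun F => Set.ext fun x => hfα x F
  have hβ : ∀ I : PrimaryIdeal E, f ⁻¹' I.1 = (β I).1 := fun I => Set.ext fun x => hfβ x I
  have hF : ∀ F, IsPrimaryFilter F → IsPrimaryFilter (f ⁻¹' F) := fun F hF =>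
    hα ⟨F, hF⟩ ▸ (α ⟨F, hF⟩).2
  have hI : ∀ I, IsPrimaryIdeal I → IsPrimaryIdeal (f ⁻¹' I) := fun I hI =>
    hβ ⟨I, hI⟩ ▸ (β ⟨I, hI⟩).2
  have hFs : ∀ F', IsPrimaryFilter F' → ∃ F, IsPrimaryFilter F ∧ f ⁻¹' F = F' := fun F' hF' => by
    obtain ⟨F, hF⟩ := h.homeo_fst.surjective (⟨F', hF'⟩ : PrimaryFilter D)
    exact ⟨F.1, F.2, (hα F).trans (congrArg Subtype.val hF)⟩
  have hIs : ∀ I', IsPrimaryIdeal I' → ∃ I, IsPrimaryIdeal I ∧ f ⁻¹' I = I' := fun I' hI' => by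
    obtain ⟨I, hI⟩ := h.homeo_snd.surjective (⟨I', hI'⟩ : PrimaryIdeal D)
    exact ⟨I.1, I.2, (hβ I).trans (congrArg Subtype.val hI)⟩
  have hrel : ∀ F I, IsPrimaryFilter F → IsPrimaryIdeal I → f ⁻¹' F ∩ f ⁻¹' I = ∅ → F ∩ I = ∅ :=
    fun F I hF hI hd => (h.rel_iff (⟨F, hF⟩ : PrimaryFilter E) (⟨I, hI⟩ : PrimaryIdeal E)).2
      ((congrArg₂ (· ∩ ·) (hα ⟨F, hF⟩) (hβ ⟨I, hI⟩)).symm.trans hd)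
  obtain ⟨h1, h2, h3⟩ := map_inf_neg_bot_of_preimage hE hF hI hFs hrel
  -- The same map between the dual algebras, with filters and ideals exchanged, yields `⊔`, `opp`
  -- and `⊤`.
  obtain ⟨h4, h5, h6⟩ := map_inf_neg_bot_of_preimage (D := Dual D) (E := Dual E) (isPure_dual hE)
    (f := f)
    (fun I h => (isPrimaryFilter_dual_iff (D := D)).2
      (hI I ((isPrimaryFilter_dual_iff (D := E)).1 h)))
    (fun F h => (isPrimaryIdeal_dual_iff (D := D)).2
      (hF F ((isPrimaryIdeal_dual_iff (D := E)).1 h)))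
    (fun I' h => (hIs I' ((isPrimaryFilter_dual_iff (D := D)).1 h)).imp fun I h =>
      ⟨(isPrimaryFilter_dual_iff (D := E)).2 h.1, h.2⟩)
    (fun I F hI' hF' hd => (Set.inter_comm I F).trans
      (hrel F I ((isPrimaryIdeal_dual_iff (D := E)).1 hF')
        ((isPrimaryFilter_dual_iff (D := E)).1 hI') ((Set.inter_comm _ _).trans hd)))
  refine ⟨f, ⟨⟨h1, h4, h2, h5, h6, h3⟩, fun x y hxy => ?_, fun y => ?_⟩,
    funext fun F => Subtype.ext (hα F), funext fun I => Subtype.ext (hβ I)⟩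
  · refine eq_of_forall_mem_iff hD (fun F' hF' => ?_) fun I' hI' => ?_
    · obtain ⟨F, -, rfl⟩ := hFs F' hF'
      rw [Set.mem_preimage, hxy, Set.mem_preimage]
    · obtain ⟨I, -, rfl⟩ := hIs I' hI'
      rw [Set.mem_preimage, hxy, Set.mem_preimage]
  -- A preimage of `y` is the element assigned to it by the inverse homeomorphism.
  · obtain ⟨a, b, hab, hal, -, hbl, -⟩ := h.exists_inverse
    obtain ⟨x, hx1, hx2⟩ := exists_mem_iff_of_isHomeo hE hab y
    refine ⟨x, eq_of_forall_mem_iff hE (fun F hF => ?_) fun I hI => ?_⟩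
    · exact (hfα x ⟨F, hF⟩).trans ((hx1 _).trans
        (Set.ext_iff.1 (congrArg Subtype.val (hal (⟨F, hF⟩ : PrimaryFilter E))) y))
    · exact (hfβ x ⟨I, hI⟩).trans ((hx2 _).trans
        (Set.ext_iff.1 (congrArg Subtype.val (hbl (⟨I, hI⟩ : PrimaryIdeal E))) y))

end Full

/-! ### The duality -/

theorem mainTheorem4 :
    ∃ (hobj : ∀ D : PDBA.{u}, (primaryContext D.carrier).IsStoneContext)
      (hmap : ∀ (D E : PDBA.{u}) (f : D ⟶ E),
        CTS.IsHomeo (primaryContext E.carrier) (primaryContext D.carrier)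
          (alphaMap f.isDBAIso.isHom) (betaMap f.isDBAIso.isHom)),
      (primaryContextFunctor hobj hmap).IsEquivalence := by
  refine ⟨fun D => isStoneContext_primaryContext D.isPure,
    fun D E f => isHomeo_of_isDBAIso f.isDBAIso, { faithful := ⟨?_⟩, full := ⟨?_⟩, essSurj := ⟨?_⟩ }⟩
  · intro D E f g hfg
    have h := congrArg Quiver.Hom.unop hfg
    refine PDBA.Hom.ext (funext fun x => eq_of_forall_mem_iff E.isPure (fun F hF => ?_)
      fun I hI => ?_)
    · exact Set.ext_iff.1 (congrArg Subtype.val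
        (congrFun (congrArg Scxt.Hom.α h) (⟨F, hF⟩ : PrimaryFilter E.carrier))) x
    · exact Set.ext_iff.1 (congrArg Subtype.val
        (congrFun (congrArg Scxt.Hom.β h) (⟨I, hI⟩ : PrimaryIdeal E.carrier))) x
  · intro D E φ
    obtain ⟨f, hf, h1, h2⟩ := exists_isDBAIso_of_isHomeo D.isPure E.isPure φ.unop.isHomeo
    exact ⟨⟨f, hf⟩, Quiver.Hom.unop_inj (Scxt.Hom.ext h1 h2)⟩
  · intro K
    let D : PDBA.{u} := ⟨K.unop.ClopenSemiconcept, Scxt.ClopenSemiconcept.isPure⟩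
    let L : Scxt.{u} := ⟨primaryContext D.carrier, isStoneContext_primaryContext D.isPure⟩
    let e : K.unop ⟶ L := ⟨Scxt.filterOf, Scxt.idealOf, Scxt.isHomeo_filterOf_idealOf K.unop⟩
    have := Scxt.isIso_of_hom e
    exact ⟨D, ⟨(asIso e).op⟩⟩
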